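/- For every real $\epsilon>0$ there exist a real $\delta>0$ and an integer $P$ such that the following holds for every prime $p\ge P$. Let $A$ be a finite multiset of elements of $\mathbb{Z}_p^2$, where $\mathbb{Z}_p=\mathbb{Z}/p\mathbb{Z}$, in which no element has multiplicity $\ge\delta p$, and let $|A|$ denote its cardinality counted with multiplicity. (1) If $|A|>(1+\epsilon)p$, then $A$ contains a zero-sum of length at most $p$, that is, there is a non-empty sub-multiset $B\subseteq A$ with $|B|\le p$ and $\sum_{b\in B}b=0$. (2) If $|A|>(2+\epsilon)p$, then $A$ contains a zero-sum of length exactly $p$, that is, there is a sub-multiset $B\subseteq A$ with $|B|=p$ and $\sum_{b\in B}b=0$. -/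

import Mathlib

open Finset

/-! The proof is a dichotomy on how the family is spread over affine lines. Suppose first that a
small subfamily of 2m elements has every point of the plane as the sum of some m of its members
(`HalfSums` with `univ`). Then a zero-sum of length m exists at once. One of length p comes from any
p - m further elements, by choosing the m-sum that cancels theirs.

Such a subfamily exists unless almost all elements lie on boundedly many rich lines of a single
direction φ = c (`exists_cover_or_exchange`). In that case a few elements are reserved on each rich
line, whose sums of fixed length fill a parallel line. Erdős–Ginzburg–Ziv, applied to the values of
φ, gives a zero-sum modulo the direction of the lines. Swapping some of its elements on one rich
line for reserved ones corrects the remaining coordinate without changing the length.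

Covering subfamilies are grown greedily: a new pair x, y, of which each sum uses exactly one,
enlarges the set Y of sums by `outflow Y (a y - a x)`. Elementary estimates lead to positive
density. From there a Fourier argument (`exists_outflow_ge`) gains a fixed multiple of |G|/p per
pair until density 2/3, and two disjoint subfamilies of that density cover G by pigeonhole. -/

/-- The number of elements of `Y` that leave `Y` under translation by `g`. -/
def outflow {G : Type*} [AddCommGroup G] [DecidableEq G] (Y : Finset G) (g : G) : ℕ :=
  #{y ∈ Y | y + g ∉ Y}

/-! ### Subadditivity of the outflow. -/

section Outflow

variable {G : Type*} [AddCommGroup G] [DecidableEq G]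

lemma outflow_zero (Y : Finset G) : outflow Y 0 = 0 := by
  simp [outflow]

/-- A point that leaves under g + h either leaves under g, or is carried by g to a point that leaves
under h. -/
lemma outflow_add_le (Y : Finset G) (g h : G) :
    outflow Y (g + h) ≤ outflow Y g + outflow Y h := by
  have hsub : {y ∈ Y | y + (g + h) ∉ Y} ⊆
      {y ∈ Y | y + g ∉ Y} ∪ ({y ∈ Y | y + h ∉ Y}).image (fun y => y - g) := by
    intro y hy
    simp only [mem_filter, mem_union, mem_image] at hy ⊢
    by_cases h1 : y + g ∈ Y
    · exact Or.inr ⟨y + g, ⟨h1, by rw [add_assoc]; exact hy.2⟩, by abel⟩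
    · exact Or.inl ⟨hy.1, h1⟩
  calc outflow Y (g + h) ≤ _ := card_le_card hsub
    _ ≤ _ := card_union_le _ _
    _ ≤ _ := Nat.add_le_add_left card_image_le _

lemma outflow_nsmul_le (Y : Finset G) (j : ℕ) (g : G) :
    outflow Y (j • g) ≤ j * outflow Y g := by
  induction j with
  | zero => simp [outflow_zero]
  | succ j ih =>
    rw [succ_nsmul, add_mul, one_mul]
    exact (outflow_add_le _ _ _).trans (Nat.add_le_add_right ih _)

lemma card_filter_add_outflow (Y : Finset G) (g : G) :
    #{y ∈ Y | y + g ∈ Y} + outflow Y g = #Y :=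
  card_filter_add_card_filter_not _

lemma card_union_image_add (Y : Finset G) (g : G) :
    #(Y ∪ Y.image (· + g)) = #Y + outflow Y g := by
  have h : Y ∪ Y.image (· + g) = Y ∪ ({y ∈ Y | y + g ∉ Y}).image (· + g) := by
    ext z
    simp only [mem_union, mem_image, mem_filter]
    constructor
    · rintro (h | ⟨y, hy, rfl⟩)
      · exact Or.inl h
      · by_cases h1 : y + g ∈ Y
        · exact Or.inl h1
        · exact Or.inr ⟨y, ⟨hy, h1⟩, rfl⟩
    · rintro (h | ⟨y, hy, rfl⟩)
      · exact Or.inl h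
      · exact Or.inr ⟨y, hy.1, rfl⟩
  rw [h, card_union_of_disjoint, card_image_of_injective _ (add_left_injective g)]
  · rfl
  · rw [Finset.disjoint_left]
    intro z hz hz'
    simp only [mem_image, mem_filter] at hz'
    obtain ⟨y, hy, rfl⟩ := hz'
    exact hy.2 hz

end Outflow

/-! ### Fourier lower bound for the outflow. -/

section Fourier

variable {G : Type*} [AddCommGroup G] [Fintype G] [DecidableEq G]

/-- The exponential sum of the character `χ` over `Y`. -/
noncomputable def charSum (Y : Finset G) (χ : AddChar G ℂ) : ℂ := ∑ y ∈ Y, χ y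

/-- Expanding the square gives the terms χ(y + g - z), and orthogonality keeps only z = y + g. -/
lemma sum_normSq_charSum_mul (Y : Finset G) (g : G) :
    ∑ χ : AddChar G ℂ, ((Complex.normSq (charSum Y χ) : ℝ) : ℂ) * χ g =
      (Fintype.card G : ℂ) * (#{y ∈ Y | y + g ∈ Y} : ℂ) := by
  have h1 : ∀ χ : AddChar G ℂ, ((Complex.normSq (charSum Y χ) : ℝ) : ℂ) * χ g =
      ∑ y ∈ Y, ∑ z ∈ Y, χ (y + g - z) := by
    intro χ
    rw [Complex.normSq_eq_conj_mul_self, mul_comm ((starRingEnd ℂ) _), charSum, map_sum,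
      sum_mul_sum, sum_mul]
    refine sum_congr rfl fun y _ => ?_
    rw [sum_mul]
    refine sum_congr rfl fun z _ => ?_
    rw [sub_eq_add_neg, AddChar.map_add_eq_mul, AddChar.map_add_eq_mul, AddChar.map_neg_eq_conj]
    ring
  simp_rw [h1]
  rw [sum_comm]
  have h2 : ∀ y ∈ Y, ∑ χ : AddChar G ℂ, ∑ z ∈ Y, χ (y + g - z) =
      if y + g ∈ Y then (Fintype.card G : ℂ) else 0 := by
    intro y _
    rw [sum_comm]
    simp_rw [AddChar.sum_apply_eq_ite, sub_eq_zero]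
    rw [sum_ite_eq]
  rw [sum_congr rfl h2, ← sum_filter, sum_const, nsmul_eq_mul, mul_comm]

lemma sum_normSq_charSum_mul_re (Y : Finset G) (g : G) :
    ∑ χ : AddChar G ℂ, Complex.normSq (charSum Y χ) * (χ g).re =
      (Fintype.card G : ℝ) * (#{y ∈ Y | y + g ∈ Y} : ℝ) := by
  have h := congrArg Complex.re (sum_normSq_charSum_mul Y g)
  rw [Complex.re_sum] at h
  simp_rw [Complex.re_ofReal_mul] at h
  rw [h]
  norm_cast

lemma sum_normSq_charSum (Y : Finset G) :
    ∑ χ : AddChar G ℂ, Complex.normSq (charSum Y χ) = (Fintype.card G : ℝ) * #Y := by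
  simpa using sum_normSq_charSum_mul_re Y 0

lemma sum_normSq_charSum_one_sub (Y : Finset G) (g : G) :
    ∑ χ : AddChar G ℂ, Complex.normSq (charSum Y χ) * (1 - (χ g).re) =
      (Fintype.card G : ℝ) * outflow Y g := by
  simp_rw [mul_sub, mul_one]
  rw [sum_sub_distrib, sum_normSq_charSum, sum_normSq_charSum_mul_re,
    ← card_filter_add_outflow Y g]
  push_cast
  ring

lemma sum_normSq_charSum_ne_zero (Y : Finset G) :
    ∑ χ ∈ univ.erase (0 : AddChar G ℂ), Complex.normSq (charSum Y χ) =
      (Fintype.card G : ℝ) * #Y - (#Y : ℝ) ^ 2 := by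
  have h := add_sum_erase univ (fun χ : AddChar G ℂ => Complex.normSq (charSum Y χ))
    (mem_univ 0)
  rw [sum_normSq_charSum] at h
  have h0 : Complex.normSq (charSum Y 0) = (#Y : ℝ) ^ 2 := by
    simp [charSum, Complex.normSq_apply, sq]
  simp only [h0] at h
  linarith

/-- The roots of unity of order `p` that are close to `1` are few. -/
lemma exists_finset_near_one (p r : ℕ) (hp : 0 < p) :
    ∃ Z : Finset ℂ, #Z ≤ 2 * r + 1 ∧
      ∀ ζ : ℂ, ζ ^ p = 1 → ζ ∈ Z ∨ 4 * (r : ℝ) / p ≤ ‖ζ - 1‖ := by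
  classical
  set e : ℕ → ℂ := fun t => Complex.exp (Complex.I * ((2 * Real.pi * t / p : ℝ) : ℂ)) with he
  refine ⟨(range (r + 1)).image e ∪ (Ico (p - r) p).image e, ?_, ?_⟩
  · refine (card_union_le _ _).trans ?_
    have h1 := card_image_le (s := range (r + 1)) (f := e)
    have h2 := card_image_le (s := Ico (p - r) p) (f := e)
    simp only [card_range, Nat.card_Ico] at h1 h2
    omega
  · intro ζ hζ
    have hp' : NeZero p := ⟨hp.ne'⟩
    obtain ⟨t, htp, rfl⟩ := (Complex.isPrimitiveRoot_exp p hp.ne').eq_pow_of_pow_eq_one hζ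
    have het : Complex.exp (2 * Real.pi * Complex.I / p) ^ t = e t := by
      rw [he, ← Complex.exp_nat_mul]
      congr 1
      push_cast
      ring
    rw [het]
    by_cases h1 : t < r + 1
    · exact Or.inl (mem_union_left _ (mem_image_of_mem _ (mem_range.2 h1)))
    by_cases h2 : p - r ≤ t
    · exact Or.inl (mem_union_right _ (mem_image_of_mem _ (mem_Ico.2 ⟨h2, htp⟩)))
    right
    have hpR : (0 : ℝ) < p := by exact_mod_cast hp
    have hpi := Real.pi_pos
    rw [he, Complex.norm_exp_I_mul_ofReal_sub_one, Real.norm_eq_abs, abs_mul, abs_two]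
    have ht1 : (r : ℝ) ≤ t := by exact_mod_cast (by omega : r ≤ t)
    have ht2 : (t : ℝ) + r ≤ p := by exact_mod_cast (by omega : t + r ≤ p)
    -- Jordan's inequality sin x ≥ 2x/π, after reflecting the angle into [0, π/2].
    have key : 2 * (r : ℝ) / p ≤ Real.sin (2 * Real.pi * t / p / 2) := by
      rcases le_total (2 * (t : ℝ)) p with h | h
      · refine le_trans ?_ (Real.mul_le_sin (by positivity) ?_)
        · rw [show 2 / Real.pi * (2 * Real.pi * t / p / 2) = 2 * t / p by field_simp]
          gcongr
        · rw [show 2 * Real.pi * t / p / 2 = Real.pi / 2 * (2 * t / p) by field_simp]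
          have : 2 * (t : ℝ) / p ≤ 1 := by rw [div_le_one hpR]; exact h
          nlinarith
      · rw [← Real.sin_pi_sub]
        have e1 : Real.pi - 2 * Real.pi * t / p / 2 = Real.pi / 2 * (2 * (p - t) / p) := by
          field_simp
        have h0 : (0 : ℝ) ≤ 2 * (p - t) / p := by
          apply div_nonneg _ hpR.le
          linarith
        rw [e1]
        refine le_trans ?_ (Real.mul_le_sin (by positivity) ?_)
        · rw [show 2 / Real.pi * (Real.pi / 2 * (2 * ((p : ℝ) - t) / p)) = 2 * (p - t) / p by
            field_simp]
          gcongr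
          linarith
        · have : 2 * ((p : ℝ) - t) / p ≤ 1 := by rw [div_le_one hpR]; linarith
          nlinarith
    have := le_abs_self (Real.sin (2 * Real.pi * t / p / 2))
    have e2 : 4 * (r : ℝ) / p = 2 * (2 * r / p) := by ring
    rw [e2]
    linarith

lemma re_geom_sum_le {ζ : ℂ} (hζ : ‖ζ‖ = 1) {c : ℝ} (hc : 0 < c) (h : c ≤ ‖ζ - 1‖) (J : ℕ) :
    ∑ j ∈ range J, (ζ ^ j).re ≤ 2 / c := by
  have hne : ζ ≠ 1 := by
    rintro rfl
    simp at h
    linarith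
  rw [← Complex.re_sum, geom_sum_eq hne]
  refine (Complex.re_le_norm _).trans ?_
  rw [norm_div]
  gcongr
  calc ‖ζ ^ J - 1‖ ≤ ‖ζ ^ J‖ + ‖(1 : ℂ)‖ := norm_sub_le _ _
    _ = 2 := by rw [norm_pow, hζ]; norm_num

/-- A family that is not concentrated on few fibres of any nontrivial character
contains an element that moves a fixed proportion `r / p` of any set `Y` of density `≤ 2/3`. -/
theorem exists_outflow_ge {ι : Type*} {p r : ℕ} {K : ℝ} (hr : 0 < r) (hrp : r ≤ p)
    (hG : ∀ g : G, p • g = 0) (d : ι → G) (I : Finset ι) (hI : I.Nonempty)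
    (hK : ∀ χ : AddChar G ℂ, χ ≠ 0 → ∀ z : ℂ, (#{i ∈ I | χ (d i) = z} : ℝ) ≤ K)
    (hrK : (2 * r + 1) * K ≤ #I / 2)
    (Y : Finset G) (hY : (#Y : ℝ) ≤ 2 / 3 * Fintype.card G) :
    ∃ i ∈ I, (#Y : ℝ) * r / (12 * p) ≤ outflow Y (d i) := by
  classical
  have hp : 0 < p := hr.trans_le hrp
  have hpR : (0 : ℝ) < p := by exact_mod_cast hp
  have hrR : (0 : ℝ) < r := by exact_mod_cast hr
  have hIpos : (0 : ℝ) < #I := by exact_mod_cast hI.card_pos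
  obtain ⟨Z, hZ, hZfar⟩ := exists_finset_near_one p r hp
  -- Long enough that the powers of a root far from 1 nearly cancel, short enough that passing from
  -- d to its multiples jd with j < J costs only a factor of order p / r.
  set J := ⌈(p : ℝ) / r⌉₊ with hJ
  have hJ1 : (p : ℝ) / r ≤ J := Nat.le_ceil _
  have hpr1 : 1 ≤ (p : ℝ) / r := by
    rw [le_div_iff₀ hrR, one_mul]; exact_mod_cast hrp
  have hJ2 : (J : ℝ) < 2 * (p / r) := by
    have := Nat.ceil_lt_add_one (by positivity : (0 : ℝ) ≤ (p : ℝ) / r)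
    linarith
  have hJpos : (0 : ℝ) < J := by linarith
  have hroot : ∀ (χ : AddChar G ℂ) (g : G), χ g ^ p = 1 := by
    intro χ g
    rw [← AddChar.map_nsmul_eq_pow, hG, AddChar.map_zero_eq_one]
  have hnorm : ∀ (χ : AddChar G ℂ) (g : G), ‖χ g‖ = 1 := fun χ g => AddChar.norm_apply χ g
  have hnn : ∀ (χ : AddChar G ℂ) (g : G), 0 ≤ 1 - (χ g).re := by
    intro χ g
    have := Complex.re_le_norm (χ g)
    rw [hnorm] at this
    linarith
  -- At least half of the indices have χ(d i) far from 1. For each of them the geometric sum has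
  -- real part at most p / (2r) ≤ J / 2.
  have hinner : ∀ χ : AddChar G ℂ, χ ≠ 0 →
      (#I : ℝ) * J / 4 ≤ ∑ i ∈ I, ∑ j ∈ range J, (1 - (χ (j • d i)).re) := by
    intro χ hχ
    have hnear : (#{i ∈ I | χ (d i) ∈ Z} : ℝ) ≤ #I / 2 := by
      have h1 : {i ∈ I | χ (d i) ∈ Z} = Z.biUnion fun z => {i ∈ I | χ (d i) = z} := by
        ext i
        simp only [mem_filter, mem_biUnion]
        constructor
        · rintro ⟨h, h'⟩
          exact ⟨_, h', h, rfl⟩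
        · rintro ⟨z, hz, h, rfl⟩
          exact ⟨h, hz⟩
      have hK0 : 0 ≤ K := le_trans (Nat.cast_nonneg _) (hK χ hχ 0)
      calc (#{i ∈ I | χ (d i) ∈ Z} : ℝ) ≤ ∑ z ∈ Z, (#{i ∈ I | χ (d i) = z} : ℝ) := by
            rw [h1]; exact_mod_cast card_biUnion_le
        _ ≤ ∑ z ∈ Z, K := sum_le_sum fun z _ => hK χ hχ z
        _ = #Z * K := by rw [sum_const, nsmul_eq_mul]
        _ ≤ (2 * r + 1) * K := by
            gcongr
            exact_mod_cast hZ
        _ ≤ _ := hrK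
    have hcard : (#{i ∈ I | χ (d i) ∈ Z} : ℝ) + #{i ∈ I | χ (d i) ∉ Z} = #I := by
      exact_mod_cast card_filter_add_card_filter_not (s := I) (fun i => χ (d i) ∈ Z)
    calc (#I : ℝ) * J / 4 ≤ #{i ∈ I | χ (d i) ∉ Z} * ((J : ℝ) / 2) := by nlinarith
      _ = ∑ i ∈ I with χ (d i) ∉ Z, (J : ℝ) / 2 := by rw [sum_const, nsmul_eq_mul]
      _ ≤ ∑ i ∈ I with χ (d i) ∉ Z, ∑ j ∈ range J, (1 - (χ (j • d i)).re) := by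
          refine sum_le_sum fun i hi => ?_
          have hfar := (hZfar _ (hroot χ (d i))).resolve_left (mem_filter.1 hi).2
          have := re_geom_sum_le (hnorm χ (d i)) (by positivity) hfar J
          simp_rw [AddChar.map_nsmul_eq_pow]
          rw [sum_sub_distrib, sum_const, card_range, nsmul_eq_mul, mul_one]
          have e : 2 / (4 * (r : ℝ) / p) = (p / r) / 2 := by field_simp; norm_num
          rw [e] at this
          linarith
      _ ≤ _ := by
          refine sum_le_sum_of_subset_of_nonneg (filter_subset _ _) fun i _ _ => ?_
          exact sum_nonneg fun j _ => hnn _ _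
  have hGpos : (0 : ℝ) < Fintype.card G := by exact_mod_cast Fintype.card_pos
  have hlow : ((Fintype.card G : ℝ) * #Y - (#Y : ℝ) ^ 2) * (#I * J / 4) ≤
      Fintype.card G * ∑ i ∈ I, ∑ j ∈ range J, (outflow Y (j • d i) : ℝ) := by
    calc ((Fintype.card G : ℝ) * #Y - (#Y : ℝ) ^ 2) * (#I * J / 4)
        = ∑ χ ∈ univ.erase (0 : AddChar G ℂ),
            Complex.normSq (charSum Y χ) * (#I * J / 4) := by
          rw [← sum_normSq_charSum_ne_zero, sum_mul]
      _ ≤ ∑ χ ∈ univ.erase (0 : AddChar G ℂ), Complex.normSq (charSum Y χ) *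
            ∑ i ∈ I, ∑ j ∈ range J, (1 - (χ (j • d i)).re) := by
          refine sum_le_sum fun χ hχ => ?_
          exact mul_le_mul_of_nonneg_left (hinner χ (ne_of_mem_erase hχ)) (Complex.normSq_nonneg _)
      _ ≤ ∑ χ : AddChar G ℂ, Complex.normSq (charSum Y χ) *
            ∑ i ∈ I, ∑ j ∈ range J, (1 - (χ (j • d i)).re) := by
          refine sum_le_sum_of_subset_of_nonneg (erase_subset _ _) fun χ _ _ => ?_
          exact mul_nonneg (Complex.normSq_nonneg _)
            (sum_nonneg fun i _ => sum_nonneg fun j _ => hnn _ _)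
      _ = _ := by
          simp_rw [mul_sum]
          rw [sum_comm]
          refine sum_congr rfl fun i _ => ?_
          rw [sum_comm]
          refine sum_congr rfl fun j _ => ?_
          exact sum_normSq_charSum_one_sub Y _
  -- The bounds on the averaged outflow collide: density at most 2/3 gives at least |Y||I|J/12,
  -- while the assumption gives at most |Y||I|J(Jr/p)/24, and Jr/p < 2.
  by_contra! hcon
  have hup : ∑ i ∈ I, ∑ j ∈ range J, (outflow Y (j • d i) : ℝ) ≤
      #I * (J * (J * ((#Y : ℝ) * r / (12 * p))) / 2) := by
    rw [← nsmul_eq_mul, ← sum_const]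
    refine sum_le_sum fun i hi => ?_
    have hx := (hcon i hi).le
    calc ∑ j ∈ range J, (outflow Y (j • d i) : ℝ)
        ≤ ∑ j ∈ range J, (j : ℝ) * ((#Y : ℝ) * r / (12 * p)) := by
          refine sum_le_sum fun j _ => ?_
          have h : (outflow Y (j • d i) : ℝ) ≤ j * outflow Y (d i) := by
            exact_mod_cast outflow_nsmul_le Y j (d i)
          exact h.trans (by gcongr)
      _ = (∑ j ∈ range J, (j : ℝ)) * ((#Y : ℝ) * r / (12 * p)) := by rw [sum_mul]
      _ ≤ (J * J / 2) * ((#Y : ℝ) * r / (12 * p)) := by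
          gcongr
          have h2 : (∑ j ∈ range J, (j : ℝ)) * 2 = J * ((J - 1 : ℕ) : ℝ) := by
            have := congrArg (Nat.cast (R := ℝ)) (Finset.sum_range_id_mul_two J)
            simpa only [Nat.cast_mul, Nat.cast_sum, Nat.cast_ofNat] using this
          have h3 : ((J - 1 : ℕ) : ℝ) ≤ J := by exact_mod_cast Nat.sub_le _ _
          nlinarith
      _ = _ := by ring
  have hY0 : (0 : ℝ) < #Y := by
    obtain ⟨i, hi⟩ := hI
    rcases Nat.eq_zero_or_pos #Y with h | h
    · have := hcon i hi
      rw [h] at this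
      simp at this
      exact absurd this (not_lt.2 (Nat.cast_nonneg _))
    · exact_mod_cast h
  have hJr : (J : ℝ) * r / p < 2 := by
    rw [div_lt_iff₀ hpR]
    calc (J : ℝ) * r < 2 * (p / r) * r := by gcongr
      _ = 2 * p := by field_simp
  have h1 : (1 / 3 : ℝ) * (Fintype.card G * #Y) ≤ Fintype.card G * #Y - (#Y : ℝ) ^ 2 := by
    nlinarith
  have h2 : (1 / 3 : ℝ) * (Fintype.card G * #Y) * (#I * J / 4) ≤
      Fintype.card G * (#I * (J * (J * ((#Y : ℝ) * r / (12 * p))) / 2)) :=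
    (mul_le_mul_of_nonneg_right h1 (by positivity)).trans
      (hlow.trans (mul_le_mul_of_nonneg_left hup hGpos.le))
  have h3 : (Fintype.card G : ℝ) * (#I * (J * (J * ((#Y : ℝ) * r / (12 * p))) / 2)) =
      (Fintype.card G * #Y * (#I * J)) * (J * r / p) / 24 := by
    field_simp
    norm_num
  have h4 : (0 : ℝ) < Fintype.card G * #Y * (#I * J) := by positivity
  rw [h3] at h2
  nlinarith

end Fourier

/-! ### Greedy growth of sums of fixed length. -/

/-- Every element of `Y` is the sum of `a` over exactly half of the index set `I`. -/
def HalfSums {ι G : Type*} [AddCommGroup G] (a : ι → G) (I : Finset ι) (m : ℕ)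
    (Y : Finset G) : Prop :=
  #I = 2 * m ∧ ∀ y ∈ Y, ∃ T ⊆ I, #T = m ∧ ∑ i ∈ T, a i = y

lemma halfSums_empty {ι G : Type*} [AddCommGroup G] (a : ι → G) : HalfSums a ∅ 0 {0} :=
  ⟨by simp, fun y hy => ⟨∅, by simp, by simp, by simpa using (mem_singleton.1 hy).symm⟩⟩

section Greedy

variable {ι G : Type*} [DecidableEq ι] [AddCommGroup G] [DecidableEq G] {a : ι → G}

/-- The new sums are Y + a x and Y + a y, whose union is a translate of Y ∪ (Y + (a y - a x)). -/
lemma HalfSums.insert_pair {I : Finset ι} {m : ℕ} {Y : Finset G} (h : HalfSums a I m Y)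
    {x y : ι} (hx : x ∉ I) (hy : y ∉ I) (hxy : x ≠ y) :
    ∃ Y' : Finset G, HalfSums a (insert x (insert y I)) (m + 1) Y' ∧
      #Y' = #Y + outflow Y (a y - a x) := by
  refine ⟨(Y ∪ Y.image (· + (a y - a x))).image (· + a x), ⟨?_, ?_⟩, ?_⟩
  · rw [card_insert_of_notMem (by simp [hxy, hx]), card_insert_of_notMem hy, h.1]
    ring
  · intro w hw
    obtain ⟨z, hz, rfl⟩ := mem_image.1 hw
    rcases mem_union.1 hz with hz | hz
    · obtain ⟨T, hTI, hT, hsum⟩ := h.2 z hz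
      have hxT : x ∉ T := fun h => hx (hTI h)
      refine ⟨insert x T, ?_, ?_, ?_⟩
      · exact insert_subset_insert _ (hTI.trans (subset_insert _ _))
      · rw [card_insert_of_notMem hxT, hT]
      · rw [sum_insert hxT, hsum, add_comm]
    · obtain ⟨u, hu, rfl⟩ := mem_image.1 hz
      obtain ⟨T, hTI, hT, hsum⟩ := h.2 u hu
      have hyT : y ∉ T := fun h => hy (hTI h)
      refine ⟨insert y T, ?_, ?_, ?_⟩
      · exact (insert_subset_insert _ hTI).trans (subset_insert _ _)
      · rw [card_insert_of_notMem hyT, hT]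
      · rw [sum_insert hyT, hsum]
        abel
  · rw [card_image_of_injective _ (add_left_injective _), card_union_image_add]

/-- Here h n is the size guaranteed after n pairs, and S' stands for what is left of S once they are
used. -/
lemma HalfSums.greedy {I₀ : Finset ι} {m₀ : ℕ} {Y₀ : Finset G} (h₀ : HalfSums a I₀ m₀ Y₀)
    (S : Finset ι) (hS : Disjoint S I₀) (h : ℕ → ℝ) (hh : h 0 ≤ #Y₀) (k : ℕ)
    (hstep : ∀ n < k, ∀ Y : Finset G, h n ≤ #Y → ∀ S' ⊆ S, #S ≤ #S' + 2 * n →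
      ∃ x ∈ S', ∃ y ∈ S', x ≠ y ∧ h (n + 1) ≤ #Y + outflow Y (a y - a x)) :
    ∃ I, I₀ ⊆ I ∧ I ⊆ I₀ ∪ S ∧ ∃ Y : Finset G, HalfSums a I (m₀ + k) Y ∧ h k ≤ #Y := by
  induction k with
  | zero => exact ⟨I₀, subset_rfl, subset_union_left, Y₀, h₀, hh⟩
  | succ k ih =>
    obtain ⟨I, hI₀, hI, Y, hIY, hY⟩ := ih fun n hn => hstep n (by omega)
    have hsd : #S ≤ #(S \ I) + 2 * k := by
      have h2 : #(S ∩ I) + #(S \ I) = #S := card_inter_add_card_sdiff S I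
      have h3 : S ∩ I ⊆ I \ I₀ := fun i hi => mem_sdiff.2
        ⟨(mem_inter.1 hi).2, Finset.disjoint_left.1 hS (mem_inter.1 hi).1⟩
      have h4 := card_le_card h3
      rw [card_sdiff_of_subset hI₀, hIY.1, h₀.1] at h4
      omega
    obtain ⟨x, hx, y, hy, hxy, hgrow⟩ := hstep k (by omega) Y hY (S \ I) sdiff_subset hsd
    obtain ⟨Y', hY', hcard⟩ := hIY.insert_pair (mem_sdiff.1 hx).2 (mem_sdiff.1 hy).2 hxy
    refine ⟨_, ?_, ?_, Y', hY', ?_⟩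
    · exact hI₀.trans ((subset_insert _ _).trans (subset_insert _ _))
    · exact insert_subset (mem_union_right _ (mem_sdiff.1 hx).1)
        (insert_subset (mem_union_right _ (mem_sdiff.1 hy).1) hI)
    · rw [hcard]
      push_cast
      exact hgrow

/-- Pigeonhole: Y₁ and g - Y₂ are too large to be disjoint. -/
lemma HalfSums.union [Fintype G] {I₁ I₂ : Finset ι} {m₁ m₂ : ℕ} {Y₁ Y₂ : Finset G}
    (h₁ : HalfSums a I₁ m₁ Y₁) (h₂ : HalfSums a I₂ m₂ Y₂) (hI : Disjoint I₁ I₂)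
    (hY : Fintype.card G < #Y₁ + #Y₂) : HalfSums a (I₁ ∪ I₂) (m₁ + m₂) univ := by
  refine ⟨by rw [card_union_of_disjoint hI, h₁.1, h₂.1, mul_add], fun g _ => ?_⟩
  have hne : ¬ Disjoint Y₁ (Y₂.image fun y => g - y) := by
    intro hd
    have h := card_le_univ (Y₁ ∪ Y₂.image fun y => g - y)
    rw [card_union_of_disjoint hd, card_image_of_injective _ (sub_right_injective (b := g))] at h
    omega
  obtain ⟨z, hz₁, hz₂⟩ := Finset.not_disjoint_iff.1 hne
  obtain ⟨y, hy, rfl⟩ := mem_image.1 hz₂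
  obtain ⟨T₁, hT₁, hc₁, hs₁⟩ := h₁.2 _ hz₁
  obtain ⟨T₂, hT₂, hc₂, hs₂⟩ := h₂.2 _ hy
  have hT : Disjoint T₁ T₂ := disjoint_of_subset_left hT₁ (disjoint_of_subset_right hT₂ hI)
  exact ⟨T₁ ∪ T₂, union_subset_union hT₁ hT₂, by rw [card_union_of_disjoint hT, hc₁, hc₂],
    by rw [sum_union hT, hs₁, hs₂]; abel⟩

variable [Fintype G]

lemma HalfSums.expand {p r k : ℕ} {K γ : ℝ} (hr : 0 < r) (hrp : r ≤ p) (hγ : 0 < γ)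
    (hG : ∀ g : G, p • g = 0) {I₀ : Finset ι} {m₀ : ℕ} {Y₀ : Finset G}
    (h₀ : HalfSums a I₀ m₀ Y₀) (hY₀ : γ * Fintype.card G ≤ #Y₀) (S : Finset ι)
    (hS : Disjoint S I₀) (hSk : 2 * k ≤ #S)
    (hK : ∀ χ : AddChar G ℂ, χ ≠ 0 → ∀ z : ℂ, (#{i ∈ S | χ (a i) = z} : ℝ) ≤ K)
    (hrK : (2 * r + 1) * K ≤ ((#S : ℝ) - 2 * k) / 2)
    (hk : 2 / 3 ≤ k * (r * γ / (12 * p))) :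
    ∃ I, I₀ ⊆ I ∧ I ⊆ I₀ ∪ S ∧ ∃ Y : Finset G, HalfSums a I (m₀ + k) Y ∧
      2 / 3 * (Fintype.card G : ℝ) ≤ #Y := by
  have hp : (0 : ℝ) < p := by exact_mod_cast hr.trans_le hrp
  have hrR : (0 : ℝ) < r := by exact_mod_cast hr
  have hGpos : (0 : ℝ) < Fintype.card G := by exact_mod_cast Fintype.card_pos
  set β := r * γ / (12 * p) with hβ
  have hβ0 : 0 < β := by positivity
  obtain ⟨I, hI₀, hI, Y, hIY, hY⟩ := h₀.greedy S hS
    -- Linear growth, capped at density 2/3; beyond the cap any two distinct indices will do.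
    (fun n => min ((γ + n * β) * Fintype.card G) (2 / 3 * Fintype.card G))
    (min_le_of_left_le (by simpa using hY₀)) k (by
      intro n hn Y hY S' hS' hcard
      rcases lt_or_ge (2 / 3 * (Fintype.card G : ℝ)) #Y with hbig | hsmall
      · obtain ⟨x, hx, y, hy, hxy⟩ := one_lt_card.1 (by omega : 1 < #S')
        exact ⟨x, hx, y, hy, hxy, min_le_of_right_le
          (hbig.le.trans (le_add_of_nonneg_right (Nat.cast_nonneg _)))⟩
      · have hγY : γ * Fintype.card G ≤ #Y ∧ (γ + n * β) * Fintype.card G ≤ #Y ∨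
            2 / 3 * (Fintype.card G : ℝ) = #Y := by
          rcases min_le_iff.1 hY with h | h
          · refine Or.inl ⟨le_trans ?_ h, h⟩
            gcongr
            exact le_add_of_nonneg_right (by positivity)
          · exact Or.inr (le_antisymm h hsmall)
        rcases hγY with ⟨hγY, hY⟩ | heq
        · obtain ⟨x, hx⟩ := card_pos.1 (by omega : 0 < #S')
          obtain ⟨y, hy, hxy⟩ := exists_outflow_ge (K := K) hr hrp hG (fun i => a i - a x) S'
            ⟨x, hx⟩ (by
              intro χ hχ z
              refine le_trans ?_ (hK χ hχ (z * χ (a x)))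
              have : {i ∈ S' | χ (a i - a x) = z} ⊆ {i ∈ S | χ (a i) = z * χ (a x)} := by
                intro i hi
                rw [mem_filter] at hi ⊢
                refine ⟨hS' hi.1, ?_⟩
                rw [← hi.2, ← AddChar.map_add_eq_mul, sub_add_cancel]
              exact_mod_cast card_le_card this)
            (by
              have h1 : (#S : ℝ) ≤ #S' + 2 * n := by exact_mod_cast hcard
              have h2 : (n : ℝ) ≤ k := by exact_mod_cast hn.le
              linarith) Y hsmall
          have hflow : β * Fintype.card G ≤ outflow Y (a y - a x) := by
            refine le_trans ?_ hxy
            calc β * Fintype.card G = (γ * Fintype.card G) * r / (12 * p) := by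
                  rw [hβ]; field_simp
              _ ≤ _ := by gcongr
          refine ⟨x, hx, y, hy, ?_, min_le_of_left_le ?_⟩
          · rintro rfl
            rw [sub_self, outflow_zero, Nat.cast_zero] at hflow
            exact absurd hflow (not_le.2 (by positivity))
          · push_cast
            linarith
        · obtain ⟨x, hx, y, hy, hxy⟩ := one_lt_card.1 (by omega : 1 < #S')
          exact ⟨x, hx, y, hy, hxy, min_le_of_right_le
            (heq.le.trans (le_add_of_nonneg_right (Nat.cast_nonneg _)))⟩)
  refine ⟨I, hI₀, hI, Y, hIY, le_trans (le_min ?_ le_rfl) hY⟩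
  gcongr
  linarith

end Greedy

/-- If a family in a group of exponent `p` has few elements on each fibre of each nontrivial
character, and any large subfamily has sums of positive density, then a small
subfamily has all of the group as its sums of a fixed length. -/
theorem exists_halfSums_univ {η θ γ : ℝ} (hη : 0 < η) (hθ : 0 < θ) (hγ : 0 < γ)
    (hθη : θ ≤ η / 4) :
    ∃ δ : ℝ, 0 < δ ∧ ∃ P : ℕ, ∀ p : ℕ, 0 < p → P ≤ p →
      ∀ (ι G : Type) [DecidableEq ι] [AddCommGroup G] [Fintype G] [DecidableEq G]
        (_ : ∀ g : G, p • g = 0) (a : ι → G) (S : Finset ι),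
        η * p ≤ #S →
        (∀ χ : AddChar G ℂ, χ ≠ 0 → ∀ z : ℂ, (#{i ∈ S | χ (a i) = z} : ℝ) ≤ δ * p) →
        (∀ S' ⊆ S, η / 2 * p ≤ #S' → ∃ I ⊆ S', ∃ n : ℕ, (n : ℝ) ≤ θ / 4 * p ∧
          ∃ Y : Finset G, HalfSums a I n Y ∧ γ * Fintype.card G ≤ #Y) →
        ∃ I ⊆ S, ∃ m : ℕ, 0 < m ∧ (m : ℝ) ≤ θ * p ∧ HalfSums a I m univ := by
  -- About 8p / (rγ) pairs are needed; this r makes that at most θp/8, leaving another θp/8 for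
  -- rounding up.
  obtain ⟨r, hr⟩ := exists_nat_gt (64 / (γ * θ))
  have hrR : (0 : ℝ) < r := lt_trans (by positivity) hr
  have hr0 : 0 < r := by exact_mod_cast hrR
  obtain ⟨Q, hQ⟩ := exists_nat_gt (8 / θ)
  -- Then 2r + 1 fibres hold at most ηp/8 elements, at most half of what remains unused throughout
  -- the growth.
  refine ⟨η / (8 * (2 * r + 1)), by positivity, max r Q, ?_⟩
  intro p hp hpP ι G _ _ _ _ hG a S hS hfib hseed
  have hpR : (0 : ℝ) < p := by exact_mod_cast hp
  have hrp : r ≤ p := (le_max_left _ _).trans hpP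
  have hQp : (Q : ℝ) ≤ p := by exact_mod_cast (le_max_right r Q).trans hpP
  have hθp : 8 ≤ θ * p := by
    have := hQ.le.trans hQp
    rwa [div_le_iff₀ hθ, mul_comm] at this
  set k := ⌈8 * (p : ℝ) / (r * γ)⌉₊ with hkdef
  have hk1 : 8 * (p : ℝ) / (r * γ) ≤ k := Nat.le_ceil _
  have hk0 : 0 < k := Nat.ceil_pos.2 (by positivity)
  have hk2 : (k : ℝ) ≤ θ / 4 * p := by
    have h1 := Nat.ceil_lt_add_one (by positivity : (0 : ℝ) ≤ 8 * (p : ℝ) / (r * γ))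
    have h2 : 8 * (p : ℝ) / (r * γ) ≤ θ / 8 * p := by
      rw [div_le_iff₀ (by positivity)]
      rw [div_lt_iff₀ (by positivity)] at hr
      nlinarith
    linarith
  have hk3 : 2 / 3 ≤ k * (r * γ / (12 * (p : ℝ))) := by
    rw [div_le_iff₀ (by positivity)] at hk1
    rw [← mul_div_assoc, le_div_iff₀ (by positivity)]
    linarith
  have hhalf : ∀ S' ⊆ S, η / 2 * p ≤ #S' → ∃ I ⊆ S', ∃ n : ℕ, 0 < n ∧ (n : ℝ) ≤ θ / 2 * p ∧
      ∃ Y : Finset G, HalfSums a I n Y ∧ 2 / 3 * (Fintype.card G : ℝ) ≤ #Y := by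
    intro S' hS' hcard
    obtain ⟨I₀, hI₀, n, hn, Y₀, hIY₀, hY₀⟩ := hseed S' hS' hcard
    have hsd : (#(S' \ I₀) : ℝ) + 2 * n = #S' := by
      rw [← card_sdiff_add_card_eq_card hI₀, hIY₀.1]
      push_cast
      ring
    have hηp : θ * p ≤ η / 4 * p := by gcongr
    obtain ⟨I, -, hI, Y, hIY, hY⟩ := hIY₀.expand (K := η / (8 * (2 * r + 1)) * p) (k := k)
      hr0 hrp hγ hG hY₀ (S' \ I₀) sdiff_disjoint
      (by
        have : 2 * (k : ℝ) ≤ #(S' \ I₀) := by nlinarith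
        exact_mod_cast this)
      (fun χ hχ z => le_trans (by
        have : {i ∈ S' \ I₀ | χ (a i) = z} ⊆ {i ∈ S | χ (a i) = z} :=
          filter_subset_filter _ (sdiff_subset.trans hS')
        exact_mod_cast card_le_card this) (hfib χ hχ z))
      (by
        have : (2 * (r : ℝ) + 1) * (η / (8 * (2 * r + 1)) * p) = η / 8 * p := by
          field_simp
        rw [this]
        linarith) hk3
    refine ⟨I, hI.trans (union_subset hI₀ sdiff_subset), n + k, by omega, ?_, Y, hIY, hY⟩
    push_cast
    linarith
  obtain ⟨I₁, hI₁, n₁, hn₁, hn₁', Y₁, hIY₁, hY₁⟩ := hhalf S subset_rfl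
    (le_trans (by gcongr; linarith) hS)
  obtain ⟨I₂, hI₂, n₂, hn₂, hn₂', Y₂, hIY₂, hY₂⟩ := hhalf (S \ I₁) sdiff_subset (by
    have hsd : (#(S \ I₁) : ℝ) + 2 * n₁ = #S := by
      rw [← card_sdiff_add_card_eq_card hI₁, hIY₁.1]
      push_cast
      ring
    have hηp : θ * p ≤ η / 4 * p := by gcongr
    nlinarith)
  refine ⟨I₁ ∪ I₂, union_subset hI₁ (hI₂.trans sdiff_subset), n₁ + n₂, by omega, ?_,
    hIY₁.union hIY₂ (disjoint_of_subset_right hI₂ disjoint_sdiff) ?_⟩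
  · push_cast
    linarith
  · have : (0 : ℝ) < Fintype.card G := by exact_mod_cast Fintype.card_pos
    have h : (Fintype.card G : ℝ) < #Y₁ + #Y₂ := by linarith
    exact_mod_cast h

/-! ### Characters and linear forms on the plane. -/

/-- The linear form on the plane over `ZMod p` with coefficients `φ`. -/
def planeForm {p : ℕ} (φ : ZMod p × ZMod p) : ZMod p × ZMod p →+ ZMod p where
  toFun v := φ.1 * v.1 + φ.2 * v.2
  map_zero' := by simp
  map_add' u v := by simp only [Prod.fst_add, Prod.snd_add]; ring

lemma planeForm_apply {p : ℕ} (φ v : ZMod p × ZMod p) : planeForm φ v = φ.1 * v.1 + φ.2 * v.2 := rfl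

/-- The direction of the fibres of `planeForm`, and the coefficients of the form vanishing
on `v`. -/
def perp {p : ℕ} (v : ZMod p × ZMod p) : ZMod p × ZMod p := (-v.2, v.1)

section Characters

variable {p : ℕ} [Fact p.Prime]

lemma AddChar.map_zmod_smul_eq_one {M : Type*} [AddCommGroup M] [Module (ZMod p) M]
    (χ : AddChar M ℂ) {w : M} (hw : χ w = 1) (s : ZMod p) : χ (s • w) = 1 := by
  rw [← ZMod.natCast_zmod_val s, Nat.cast_smul_eq_nsmul, AddChar.map_nsmul_eq_pow, hw, one_pow]

lemma AddChar.sub_eq_one_of_eq {M : Type*} [AddCommGroup M] (χ : AddChar M ℂ) {u v : M}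
    (h : χ u = χ v) : χ (u - v) = 1 := by
  rw [AddChar.map_sub_eq_div, h, div_self (fun h0 => by simpa [h0] using (χ.val_isUnit v))]

lemma AddChar.injective_of_ne_zero_zmod {χ : AddChar (ZMod p) ℂ} (hχ : χ ≠ 0) :
    Function.Injective χ := by
  intro u v huv
  by_contra hne
  have hw := χ.sub_eq_one_of_eq huv
  refine hχ (DFunLike.ext _ _ fun g => ?_)
  have := χ.map_zmod_smul_eq_one (p := p) hw (g * (u - v)⁻¹)
  rwa [smul_eq_mul, inv_mul_cancel_right₀ (sub_ne_zero.2 hne)] at this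

lemma perp_ne_zero {v : ZMod p × ZMod p} (hv : v ≠ 0) : perp v ≠ 0 := by
  intro h
  apply hv
  simp only [perp, Prod.mk_eq_zero, neg_eq_zero] at h
  exact Prod.ext h.2 h.1

lemma planeForm_perp_self (v : ZMod p × ZMod p) : planeForm (perp v) v = 0 := by
  rw [planeForm_apply, perp]
  ring

/-- Cramer's rule: `planeForm (perp v) w` is the determinant of v and w. -/
lemma eq_smul_add_smul_of_planeForm_perp_ne_zero {v w : ZMod p × ZMod p}
    (h : planeForm (perp v) w ≠ 0) (u : ZMod p × ZMod p) :
    ∃ s t : ZMod p, u = s • v + t • w := by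
  refine ⟨-planeForm (perp w) u / planeForm (perp v) w,
    planeForm (perp v) u / planeForm (perp v) w, ?_⟩
  have hinv := mul_inv_cancel₀ h
  simp only [planeForm_apply, perp] at hinv ⊢
  ext
  · simp only [Prod.fst_add, Prod.smul_fst, smul_eq_mul]
    linear_combination (-u.1) * hinv
  · simp only [Prod.snd_add, Prod.smul_snd, smul_eq_mul]
    linear_combination (-u.2) * hinv

lemma planeForm_pair_injective {φ ψ : ZMod p × ZMod p} (h : planeForm (perp φ) ψ ≠ 0) :
    Function.Injective fun v => (planeForm φ v, planeForm ψ v) := by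
  intro u v huv
  obtain ⟨h1, h2⟩ := Prod.mk.inj huv
  simp only [planeForm_apply, perp] at h h1 h2
  refine Prod.ext (mul_left_cancel₀ h ?_) (mul_left_cancel₀ h ?_)
  · linear_combination ψ.2 * h1 - φ.2 * h2
  · linear_combination φ.1 * h2 - ψ.1 * h1

lemma planeForm_eq_of_parallel {φ ψ : ZMod p × ZMod p} (hψ : ψ ≠ 0)
    (h : planeForm (perp φ) ψ = 0) {u v : ZMod p × ZMod p} (huv : planeForm ψ u = planeForm ψ v) :
    planeForm φ u = planeForm φ v := by
  simp only [planeForm_apply, perp] at h huv ⊢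
  by_cases h1 : ψ.1 = 0
  · have h2 : ψ.2 ≠ 0 := fun h2 => hψ (Prod.ext h1 h2)
    refine mul_left_cancel₀ h2 ?_
    linear_combination φ.2 * huv + (u.1 - v.1) * h
  · refine mul_left_cancel₀ h1 ?_
    linear_combination φ.1 * huv - (u.2 - v.2) * h

lemma exists_planeForm_perp_ne_zero {φ : ZMod p × ZMod p} (hφ : φ ≠ 0) :
    ∃ ψ, planeForm (perp φ) ψ ≠ 0 := by
  by_contra! h
  have h1 := h (1, 0)
  have h2 := h (0, 1)
  simp only [planeForm_apply, perp, mul_one, mul_zero, add_zero, zero_add, neg_eq_zero] at h1 h2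
  exact hφ (Prod.ext h2 h1)

/-- If w ≠ 0 is in the kernel, nothing independent of w is, so fibres of χ lie on lines parallel to
w. Bounds on lines thus control all character fibres. -/
lemma AddChar.exists_planeForm {χ : AddChar (ZMod p × ZMod p) ℂ} (hχ : χ ≠ 0) :
    ∃ φ : ZMod p × ZMod p, φ ≠ 0 ∧ ∀ u v, χ u = χ v → planeForm φ u = planeForm φ v := by
  by_cases hker : ∃ w, w ≠ 0 ∧ χ w = 1
  · obtain ⟨w, hw, hw1⟩ := hker
    refine ⟨perp w, perp_ne_zero hw, fun u v huv => ?_⟩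
    rw [← sub_eq_zero, ← map_sub]
    by_contra hne
    refine hχ (DFunLike.ext _ _ fun g => ?_)
    obtain ⟨s, t, rfl⟩ := eq_smul_add_smul_of_planeForm_perp_ne_zero hne g
    rw [AddChar.map_add_eq_mul, χ.map_zmod_smul_eq_one hw1,
      χ.map_zmod_smul_eq_one (χ.sub_eq_one_of_eq huv)]
    simp
  · push Not at hker
    refine ⟨(1, 0), by simp, fun u v huv => ?_⟩
    by_contra hne
    exact hker (u - v) (fun h => hne (by rw [sub_eq_zero.1 h])) (χ.sub_eq_one_of_eq huv)

end Characters

/-! ### Covering `ZMod p`. -/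

section Line

variable {p : ℕ} [Fact p.Prime]

lemma one_le_outflow_zmod {Y : Finset (ZMod p)} (hY : Y.Nonempty) (hYp : #Y < p) {d : ZMod p}
    (hd : d ≠ 0) : 1 ≤ outflow Y d := by
  rw [Nat.one_le_iff_ne_zero]
  intro h
  have hcl : ∀ y ∈ Y, y + d ∈ Y := by
    simpa [outflow, filter_eq_empty_iff] using h
  obtain ⟨y, hy⟩ := hY
  have hmul : ∀ n : ℕ, y + n * d ∈ Y := by
    intro n
    induction n with
    | zero => simpa using hy
    | succ n ih =>
      have := hcl _ ih
      rwa [add_assoc, ← add_one_mul, ← Nat.cast_succ] at this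
  have huniv : Y = univ := by
    refine eq_univ_of_forall fun z => ?_
    have := hmul ((z - y) / d).val
    rwa [ZMod.natCast_zmod_val, div_mul_cancel₀ _ hd, add_sub_cancel] at this
  rw [huniv, card_univ, ZMod.card] at hYp
  exact lt_irrefl _ hYp

/-- A family in `ZMod p` without elements of high multiplicity contains a small
subfamily whose sums of some fixed length cover `ZMod p`. -/
theorem exists_halfSums_zmod {η θ : ℝ} (hη : 0 < η) (hθ : 0 < θ) :
    ∃ δ : ℝ, 0 < δ ∧ ∃ P : ℕ, ∀ p : ℕ, p.Prime → P ≤ p →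
      ∀ (ι : Type) [DecidableEq ι] (b : ι → ZMod p) (S : Finset ι) [Fintype (ZMod p)],
        η * p ≤ #S → (∀ c, (#{i ∈ S | b i = c} : ℝ) ≤ δ * p) →
        ∃ I ⊆ S, ∃ m : ℕ, 0 < m ∧ (m : ℝ) ≤ θ * p ∧ HalfSums b I m univ := by
  set θ₀ := min (min θ 1) (η / 4) with hθ₀
  have hθ₀pos : 0 < θ₀ := lt_min (lt_min hθ one_pos) (by positivity)
  obtain ⟨δ, hδ, P, hmain⟩ := exists_halfSums_univ (γ := θ₀ / 8) hη hθ₀pos (by positivity)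
    (min_le_right _ _)
  obtain ⟨Q, hQ⟩ := exists_nat_gt (8 / θ₀)
  refine ⟨min δ (η / 8), lt_min hδ (by positivity), max P Q, ?_⟩
  intro p hp hpP ι _ b S _ hS hmult
  have : Fact p.Prime := ⟨hp⟩
  have hpR : (0 : ℝ) < p := by exact_mod_cast hp.pos
  have hQp : (Q : ℝ) ≤ p := by exact_mod_cast (le_max_right P Q).trans hpP
  have hθp : 8 ≤ θ₀ * p := by
    have := hQ.le.trans hQp
    rwa [div_le_iff₀ hθ₀pos, mul_comm] at this
  have hθη : θ₀ * p ≤ η / 4 * p := by gcongr; exact min_le_right _ _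
  have hcard : Fintype.card (ZMod p) = p := ZMod.card p
  obtain ⟨I, hI, m, hm, hmp, hIm⟩ := hmain p hp.pos ((le_max_left _ _).trans hpP) ι (ZMod p)
    (fun g => by simp) b S hS
    (by
      intro χ hχ z
      by_cases hz : ∃ c, χ c = z
      · obtain ⟨c, rfl⟩ := hz
        simp_rw [(AddChar.injective_of_ne_zero_zmod hχ).eq_iff]
        exact (hmult c).trans (by gcongr; exact min_le_left _ _)
      · push Not at hz
        rw [filter_eq_empty_iff.2 fun i _ => hz (b i)]
        simp only [card_empty, Nat.cast_zero]
        positivity)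
    (by
      intro S' hS' hcS'
      set n := ⌊θ₀ / 4 * p⌋₊ with hn
      have hn1 : (n : ℝ) ≤ θ₀ / 4 * p := Nat.floor_le (by positivity)
      have hn2 : θ₀ / 4 * p < n + 1 := Nat.lt_floor_add_one _
      obtain ⟨I, -, hI, Y, hIY, hY⟩ := (halfSums_empty b).greedy S' (by simp)
        -- A gain of 1 per pair suffices: linearly many pairs already give positive density in `ZMod
        -- p`.
        (fun n => min ((n : ℝ) + 1) p) (min_le_of_left_le (by simp)) n (by
          intro k hk Y hY S'' hS'' hcS''
          have h1 : (#S' : ℝ) ≤ #S'' + 2 * k := by exact_mod_cast hcS''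
          have h2 : (k : ℝ) ≤ n := by exact_mod_cast hk.le
          have hbig : η / 8 * p < #S'' := by nlinarith
          obtain ⟨x, hx⟩ : S''.Nonempty := by
            rw [← card_pos]
            have : (0 : ℝ) < #S'' := lt_trans (by positivity) hbig
            exact_mod_cast this
          have hy : ∃ y ∈ S'', b y ≠ b x := by
            by_contra! hcon
            have h3 : S'' ⊆ {i ∈ S | b i = b x} := fun i hi =>
              mem_filter.2 ⟨hS' (hS'' hi), hcon i hi⟩
            have h4 : (#S'' : ℝ) ≤ #{i ∈ S | b i = b x} := by exact_mod_cast card_le_card h3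
            have h5 : min δ (η / 8) * p ≤ η / 8 * p := by gcongr; exact min_le_right _ _
            linarith [hmult (b x)]
          obtain ⟨y, hy, hxy⟩ := hy
          refine ⟨x, hx, y, hy, fun h => hxy (by rw [h]), ?_⟩
          rcases lt_or_ge #Y p with hYp | hYp
          · have hYpR : (#Y : ℝ) < p := by exact_mod_cast hYp
            have hkY : (k : ℝ) + 1 ≤ #Y := by
              rcases min_le_iff.1 hY with h | h
              · exact h
              · linarith
            have hYne : Y.Nonempty := by
              rw [← card_pos]
              have : (0 : ℝ) < #Y := by linarith [(Nat.cast_nonneg k : (0 : ℝ) ≤ k)]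
              exact_mod_cast this
            have := one_le_outflow_zmod hYne hYp (sub_ne_zero.2 hxy)
            have h6 : (1 : ℝ) ≤ outflow Y (b y - b x) := by exact_mod_cast this
            refine min_le_of_left_le ?_
            push_cast
            linarith
          · refine min_le_of_right_le (le_trans (by exact_mod_cast hYp)
              (le_add_of_nonneg_right (Nat.cast_nonneg _))))
      refine ⟨I, by simpa using hI, n, hn1, Y, by simpa using hIY, le_trans ?_ hY⟩
      rw [hcard]
      refine le_min (by linarith) ?_
      nlinarith [min_le_right θ 1, min_le_left (min θ 1) (η / 4)])
  exact ⟨I, hI, m, hm, hmp.trans (by gcongr; exact (min_le_left _ _).trans (min_le_left _ _)), hIm⟩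

end Line

/-! ### Covering the plane. -/

section Plane

variable {p : ℕ} [Fact p.Prime]

/-- Each fibre of f that meets Y has a point leaving Y under d, or contains a full line of p points
of Y. -/
lemma card_image_mul_le_outflow {Y : Finset (ZMod p × ZMod p)} {d : ZMod p × ZMod p} (hd : d ≠ 0)
    {f : ZMod p × ZMod p →+ ZMod p} (hf : f d = 0) :
    #(Y.image f) * p ≤ p * outflow Y d + #Y := by
  have hfib : ∀ c ∈ Y.image f, p ≤ p * #{y ∈ Y | y + d ∉ Y ∧ f y = c} + #{y ∈ Y | f y = c} := by
    intro c hc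
    by_cases hout : ∃ y ∈ Y, y + d ∉ Y ∧ f y = c
    · obtain ⟨y, hy, h⟩ := hout
      have : 0 < #{y ∈ Y | y + d ∉ Y ∧ f y = c} := card_pos.2 ⟨y, mem_filter.2 ⟨hy, h⟩⟩
      nlinarith
    · push Not at hout
      obtain ⟨y, hy, rfl⟩ := mem_image.1 hc
      have hmul : ∀ n : ℕ, y + n • d ∈ Y ∧ f (y + n • d) = f y := by
        intro n
        induction n with
        | zero => simpa using hy
        | succ n ih =>
          have hmem : y + n • d + d ∈ Y := by
            by_contra h
            exact hout _ ih.1 h ih.2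
          rw [succ_nsmul, ← add_assoc]
          exact ⟨hmem, by rw [map_add, hf, add_zero, ih.2]⟩
      have hinj : Function.Injective fun s : ZMod p => y + s • d := by
        intro s t hst
        exact smul_left_injective (ZMod p) hd (add_left_cancel hst)
      have hsub : univ.image (fun s : ZMod p => y + s • d) ⊆ {z ∈ Y | f z = f y} := by
        intro z hz
        obtain ⟨s, -, rfl⟩ := mem_image.1 hz
        rw [← ZMod.natCast_zmod_val s, Nat.cast_smul_eq_nsmul]
        exact mem_filter.2 (hmul s.val)
      have := card_le_card hsub
      rw [card_image_of_injective _ hinj, card_univ, ZMod.card] at this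
      omega
  calc #(Y.image f) * p = ∑ _c ∈ Y.image f, p := by rw [sum_const, smul_eq_mul]
    _ ≤ ∑ c ∈ Y.image f, (p * #{y ∈ Y | y + d ∉ Y ∧ f y = c} + #{y ∈ Y | f y = c}) :=
        sum_le_sum hfib
    _ = p * outflow Y d + #Y := by
        rw [sum_add_distrib, ← mul_sum, ← card_eq_sum_card_image]
        congr 2
        simp_rw [← filter_filter]
        exact (card_eq_sum_card_fiberwise fun y hy =>
          mem_image_of_mem _ (mem_filter.1 hy).1).symm

/-- Y lies in the product of its projections along v and w, so one of them has at least √|Y| points.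
At most |Y|/p ≤ √|Y|/2 of these can come from full lines. -/
lemma sqrt_card_le_outflow {Y : Finset (ZMod p × ZMod p)}
    (hYp : (#Y : ℝ) ≤ (p : ℝ) ^ 2 / 4) {v w : ZMod p × ZMod p}
    (hvw : planeForm (perp v) w ≠ 0) :
    √(#Y : ℝ) / 2 ≤ outflow Y v ∨ √(#Y : ℝ) / 2 ≤ outflow Y w := by
  have hpR : (0 : ℝ) < p := by exact_mod_cast (Fact.out : p.Prime).pos
  have hv : v ≠ 0 := by rintro rfl; simp [planeForm_apply, perp] at hvw
  have hw : w ≠ 0 := by rintro rfl; simp at hvw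
  have hprod : #Y ≤ #(Y.image (planeForm (perp v))) * #(Y.image (planeForm (perp w))) := by
    rw [← card_product]
    refine card_le_card_of_injOn (fun y => (planeForm (perp v) y, planeForm (perp w) y)) ?_ ?_
    · intro y hy
      exact mem_product.2 ⟨mem_image_of_mem _ hy, mem_image_of_mem _ hy⟩
    · refine (planeForm_pair_injective (p := p) ?_).injOn
      simp only [planeForm_apply, perp] at hvw ⊢
      convert hvw using 1
      ring
  have hsq : √(#Y : ℝ) ^ 2 = #Y := Real.sq_sqrt (Nat.cast_nonneg _)
  have hsq0 := Real.sqrt_nonneg (#Y : ℝ)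
  have hle : √(#Y : ℝ) ≤ p / 2 := Real.sqrt_le_iff.2 ⟨by positivity, by linarith⟩
  have key : ∀ d : ZMod p × ZMod p, d ≠ 0 → √(#Y : ℝ) ≤ #(Y.image (planeForm (perp d))) →
      √(#Y : ℝ) / 2 ≤ outflow Y d := by
    intro d hd hr
    have h1 : (#(Y.image (planeForm (perp d))) : ℝ) * p ≤ p * outflow Y d + #Y := by
      exact_mod_cast card_image_mul_le_outflow hd (planeForm_perp_self d)
    have h2 : √(#Y : ℝ) / 2 * p ≤ outflow Y d * p := by nlinarith
    exact le_of_mul_le_mul_right h2 hpR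
  by_cases hr : √(#Y : ℝ) ≤ #(Y.image (planeForm (perp v)))
  · exact Or.inl (key v hv hr)
  · refine Or.inr (key w hw ?_)
    by_contra hr'
    push Not at hr hr'
    have h3 : (#Y : ℝ) ≤
        #(Y.image (planeForm (perp v))) * #(Y.image (planeForm (perp w))) := by
      exact_mod_cast hprod
    nlinarith [(Nat.cast_nonneg _ : (0 : ℝ) ≤ #(Y.image (planeForm (perp v)))),
      (Nat.cast_nonneg _ : (0 : ℝ) ≤ #(Y.image (planeForm (perp w))))]

/-- A family in the plane over `ZMod p` with few elements on each affine line contains a small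
subfamily whose sums of some fixed length cover the plane. -/
theorem exists_halfSums_plane {η θ : ℝ} (hη : 0 < η) (hθ : 0 < θ) :
    ∃ δ : ℝ, 0 < δ ∧ ∃ P : ℕ, ∀ p : ℕ, p.Prime → P ≤ p →
      ∀ (ι : Type) [DecidableEq ι] (a : ι → ZMod p × ZMod p) (S : Finset ι) [Fintype (ZMod p)],
        η * p ≤ #S →
        (∀ φ, φ ≠ 0 → ∀ c, (#{i ∈ S | planeForm φ (a i) = c} : ℝ) ≤ δ * p) →
        ∃ I ⊆ S, ∃ m : ℕ, 0 < m ∧ (m : ℝ) ≤ θ * p ∧ HalfSums a I m univ := by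
  set θ₀ := min (min θ 1) (η / 4) with hθ₀
  have hθ₀pos : 0 < θ₀ := lt_min (lt_min hθ one_pos) (by positivity)
  have hθ₀1 : θ₀ ≤ 1 := (min_le_left _ _).trans (min_le_right _ _)
  obtain ⟨δ, hδ, P, hmain⟩ := exists_halfSums_univ (γ := θ₀ ^ 2 / 1600) hη hθ₀pos (by positivity)
    (min_le_right _ _)
  obtain ⟨Q, hQ⟩ := exists_nat_gt (8 / θ₀)
  refine ⟨min δ (η / 8), lt_min hδ (by positivity), max P Q, ?_⟩
  intro p hp hpP ι _ a S _ hS hline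
  have : Fact p.Prime := ⟨hp⟩
  have hpR : (0 : ℝ) < p := by exact_mod_cast hp.pos
  have hp2 : (2 : ℝ) ≤ p := by exact_mod_cast hp.two_le
  have hQp : (Q : ℝ) ≤ p := by exact_mod_cast (le_max_right P Q).trans hpP
  have hθp : 8 ≤ θ₀ * p := by
    have := hQ.le.trans hQp
    rwa [div_le_iff₀ hθ₀pos, mul_comm] at this
  have hθη : θ₀ * p ≤ η / 4 * p := by gcongr; exact min_le_right _ _
  have hcard : (Fintype.card (ZMod p × ZMod p) : ℝ) = (p : ℝ) ^ 2 := by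
    rw [Fintype.card_prod, ZMod.card]
    push_cast
    ring
  obtain ⟨I, hI, m, hm, hmp, hIm⟩ := hmain p hp.pos ((le_max_left _ _).trans hpP) ι
    (ZMod p × ZMod p) (fun g => by ext <;> simp) a S hS
    (by
      intro χ hχ z
      by_cases hz : ∃ v, χ v = z
      · obtain ⟨v, rfl⟩ := hz
        obtain ⟨φ, hφ, hχφ⟩ := AddChar.exists_planeForm hχ
        have hsub : {i ∈ S | χ (a i) = χ v} ⊆ {i ∈ S | planeForm φ (a i) = planeForm φ v} :=
          monotone_filter_right _ fun i _ => hχφ _ _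
        calc (#{i ∈ S | χ (a i) = χ v} : ℝ) ≤ #{i ∈ S | planeForm φ (a i) = planeForm φ v} := by
              exact_mod_cast card_le_card hsub
          _ ≤ _ := hline φ hφ _
          _ ≤ δ * p := by gcongr; exact min_le_left _ _
      · push Not at hz
        rw [filter_eq_empty_iff.2 fun i _ => hz (a i)]
        simp only [card_empty, Nat.cast_zero]
        positivity)
    (by
      intro S' hS' hcS'
      set n := ⌊θ₀ / 4 * p⌋₊ with hn
      have hn1 : (n : ℝ) ≤ θ₀ / 4 * p := Nat.floor_le (by positivity)
      have hn2 : θ₀ / 4 * p < n + 1 := Nat.lt_floor_add_one _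
      obtain ⟨I, -, hI, Y, hIY, hY⟩ := (halfSums_empty a).greedy S' (by simp)
        -- Gaining √|Y|/2 per pair gives quadratic growth; 1/5 works because 2/5 + 1/25 ≤ 1/2.
        (fun n => min ((1 + (n : ℝ) / 5) ^ 2) ((p : ℝ) ^ 2 / 4)) (min_le_of_left_le (by simp)) n (by
          intro k hk Y hY S'' hS'' hcS''
          have h1 : (#S' : ℝ) ≤ #S'' + 2 * k := by exact_mod_cast hcS''
          have h2 : (k : ℝ) ≤ n := by exact_mod_cast hk.le
          have hbig : η / 8 * p < #S'' := by nlinarith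
          obtain ⟨x, hx⟩ : S''.Nonempty := by
            rw [← card_pos]
            have : (0 : ℝ) < #S'' := lt_trans (by positivity) hbig
            exact_mod_cast this
          have hoff : ∀ φ, φ ≠ 0 → ∃ y ∈ S'', planeForm φ (a y - a x) ≠ 0 := by
            intro φ hφ
            by_contra! hcon
            have h3 : S'' ⊆ {i ∈ S | planeForm φ (a i) = planeForm φ (a x)} := fun i hi =>
              mem_filter.2 ⟨hS' (hS'' hi), by simpa [sub_eq_zero] using hcon i hi⟩
            have h4 : (#S'' : ℝ) ≤ #{i ∈ S | planeForm φ (a i) = planeForm φ (a x)} := by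
              exact_mod_cast card_le_card h3
            have h5 : min δ (η / 8) * p ≤ η / 8 * p := by gcongr; exact min_le_right _ _
            linarith [hline φ hφ (planeForm φ (a x))]
          obtain ⟨y, hy, hxy⟩ := hoff (1, 0) (by simp)
          have hyx : a y - a x ≠ 0 := fun h => hxy (by rw [h, map_zero])
          obtain ⟨z, hz, hxyz⟩ := hoff _ (perp_ne_zero hyx)
          have hzx : a z - a x ≠ 0 := fun h => hxyz (by rw [h, map_zero])
          have hxy' : x ≠ y := by rintro rfl; simp at hyx
          have hxz' : x ≠ z := by rintro rfl; simp at hzx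
          rcases le_or_gt ((p : ℝ) ^ 2 / 4) (#Y : ℝ) with hYp | hYp
          · exact ⟨x, hx, y, hy, hxy', min_le_of_right_le (hYp.trans
              (le_add_of_nonneg_right (Nat.cast_nonneg _)))⟩
          have hkY : (1 + (k : ℝ) / 5) ^ 2 ≤ #Y := by
            rcases min_le_iff.1 hY with h | h
            · exact h
            · exact absurd h (not_le.2 hYp)
          have hsq : √(#Y : ℝ) ^ 2 = #Y := Real.sq_sqrt (Nat.cast_nonneg _)
          have hk1 : 1 + (k : ℝ) / 5 ≤ √(#Y : ℝ) := Real.le_sqrt_of_sq_le hkY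
          have hk0 : (0 : ℝ) ≤ k := Nat.cast_nonneg k
          have hgrow : (1 + ((k + 1 : ℕ) : ℝ) / 5) ^ 2 ≤ #Y + √(#Y : ℝ) / 2 := by
            push_cast
            nlinarith
          rcases sqrt_card_le_outflow hYp.le hxyz with h | h
          · exact ⟨x, hx, y, hy, hxy', min_le_of_left_le (by linarith)⟩
          · exact ⟨x, hx, z, hz, hxz', min_le_of_left_le (by linarith)⟩)
      refine ⟨I, by simpa using hI, n, hn1, Y, by simpa using hIY, le_trans ?_ hY⟩
      rw [hcard]
      have hn3 : θ₀ / 8 * p ≤ n := by linarith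
      refine le_min ?_ ?_
      · calc θ₀ ^ 2 / 1600 * (p : ℝ) ^ 2 = (θ₀ / 8 * p / 5) ^ 2 := by ring
          _ ≤ (1 + (n : ℝ) / 5) ^ 2 := by
            gcongr
            linarith
      · have : θ₀ ^ 2 ≤ 1 := pow_le_one₀ hθ₀pos.le hθ₀1
        nlinarith [sq_nonneg (p : ℝ)])
  exact ⟨I, hI, m, hm, hmp.trans (by gcongr; exact (min_le_left _ _).trans (min_le_left _ _)), hIm⟩

end Plane

/-! ### Zero-sums in `ZMod p`, and exchanges along lines. -/

/-- Erdős–Ginzburg–Ziv after padding with p - 1 zeros, too few to make up the p chosen terms. -/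
lemma exists_zero_sum_card_le {ι : Type*} {p : ℕ} (hp : 0 < p) (b : ι → ZMod p) (B : Finset ι) (hB : p ≤ #B) :
    ∃ T ⊆ B, T.Nonempty ∧ #T ≤ p ∧ ∑ i ∈ T, b i = 0 := by
  obtain ⟨t, ht, htc, hsum⟩ := ZMod.erdos_ginzburg_ziv (n := p)
    (s := B.disjSum (univ : Finset (Fin (p - 1)))) (Sum.elim b 0) (by
      rw [card_disjSum, card_univ, Fintype.card_fin]
      omega)
  have hcard := card_toLeft_add_card_toRight (u := t)
  have hright : #t.toRight ≤ p - 1 := by simpa using card_le_univ t.toRight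
  refine ⟨t.toLeft, ?_, ?_, by omega, ?_⟩
  · intro i hi
    simpa using ht (mem_toLeft.1 hi)
  · rw [← card_pos]
    omega
  · rw [← toLeft_disjSum_toRight (u := t), sum_disjSum] at hsum
    simpa using hsum

/-- A largest zero-sum T of length at most p works. If |T| < N, a zero-sum disjoint from T also has
fewer than N terms by maximality, and the union still fits in p. -/
lemma exists_zero_sum_card_mem_Icc {ι : Type*} [DecidableEq ι] {p : ℕ} (hp : 0 < p) (b : ι → ZMod p) (B : Finset ι) {N : ℕ}
    (hN : 2 * N ≤ p) (hB : p + N ≤ #B) :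
    ∃ T ⊆ B, N ≤ #T ∧ #T ≤ p ∧ ∑ i ∈ T, b i = 0 := by
  obtain ⟨T, hT, hmax⟩ := exists_max_image {T ∈ B.powerset | #T ≤ p ∧ ∑ i ∈ T, b i = 0} card
    ⟨∅, by simp⟩
  rw [mem_filter, mem_powerset] at hT
  refine ⟨T, hT.1, ?_, hT.2⟩
  by_contra! hlt
  have hsd := card_sdiff_add_card_eq_card hT.1
  obtain ⟨T', hT', hne, hT'p, hsum⟩ := exists_zero_sum_card_le hp b (B \ T) (by omega)
  have hdisj : Disjoint T T' := disjoint_of_subset_right hT' disjoint_sdiff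
  have hpos := hne.card_pos
  have h1 := hmax T' (mem_filter.2 ⟨mem_powerset.2 (hT'.trans sdiff_subset), hT'p, hsum⟩)
  have h2 := hmax (T ∪ T') (mem_filter.2 ⟨mem_powerset.2
    (union_subset hT.1 (hT'.trans sdiff_subset)),
    by rw [card_union_of_disjoint hdisj]; omega,
    by rw [sum_union hdisj, hT.2.2, hsum, add_zero]⟩)
  rw [card_union_of_disjoint hdisj] at h2
  omega

/-- A family on a line of the plane over `ZMod p` without elements of high multiplicity contains
a small subfamily whose sums of some fixed length `m` cover the `m`-th multiple of the line. -/
theorem exists_line_sums {η θ : ℝ} (hη : 0 < η) (hθ : 0 < θ) :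
    ∃ δ : ℝ, 0 < δ ∧ ∃ P : ℕ, ∀ p : ℕ, p.Prime → P ≤ p →
      ∀ (ι : Type) [DecidableEq ι] (a : ι → ZMod p × ZMod p) (L : Finset ι)
        (φ : ZMod p × ZMod p) (c : ZMod p), φ ≠ 0 → (∀ i ∈ L, planeForm φ (a i) = c) →
        η * p ≤ #L → (∀ v, (#{i ∈ L | a i = v} : ℝ) ≤ δ * p) →
        ∃ I ⊆ L, ∃ m : ℕ, 0 < m ∧ (m : ℝ) ≤ θ * p ∧ #I = 2 * m ∧
          ∀ g, planeForm φ g = m • c → ∃ T ⊆ I, #T = m ∧ ∑ i ∈ T, a i = g := by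
  obtain ⟨δ, hδ, P, hmain⟩ := exists_halfSums_zmod hη hθ
  refine ⟨δ, hδ, P, ?_⟩
  intro p hp hpP ι _ a L φ c hφ hL hcard hmult
  have : Fact p.Prime := ⟨hp⟩
  obtain ⟨ψ, hψ⟩ := exists_planeForm_perp_ne_zero hφ
  have hinj := planeForm_pair_injective hψ
  obtain ⟨I, hI, m, hm, hmp, hIc, hsums⟩ := hmain p hp hpP ι (fun i => planeForm ψ (a i)) L hcard
    (by
      intro d
      rcases eq_empty_or_nonempty {i ∈ L | planeForm ψ (a i) = d} with h | ⟨i, hi⟩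
      · rw [h, card_empty, Nat.cast_zero]
        positivity
      · refine le_trans ?_ (hmult (a i))
        have hsub : {i ∈ L | planeForm ψ (a i) = d} ⊆ {j ∈ L | a j = a i} := by
          intro j hj
          rw [mem_filter] at hi hj ⊢
          exact ⟨hj.1, hinj (Prod.ext ((hL j hj.1).trans (hL i hi.1).symm)
            (hj.2.trans hi.2.symm))⟩
        exact_mod_cast card_le_card hsub)
  refine ⟨I, hI, m, hm, hmp, hIc, fun g hg => ?_⟩
  obtain ⟨T, hT, hTm, hsum⟩ := hsums (planeForm ψ g) (mem_univ _)
  refine ⟨T, hT, hTm, hinj (Prod.ext ?_ ?_)⟩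
  · simp only [map_sum]
    rw [sum_congr rfl fun i hi => hL i (hI (hT hi)), sum_const, hTm, hg]
  · simpa only [map_sum] using hsum

/-- A zero-sum modulo the direction of the lines `φ = c` that has at least `m` elements on
one of them becomes a zero-sum after an exchange with a reserved set. -/
lemma exists_exchange {ι : Type*} [DecidableEq ι] {p : ℕ} {a : ι → ZMod p × ZMod p} {φ : ZMod p × ZMod p} {c : ZMod p}
    {I B : Finset ι} {m : ℕ} (hIB : Disjoint I B)
    (hI : ∀ g, planeForm φ g = m • c → ∃ T ⊆ I, #T = m ∧ ∑ i ∈ T, a i = g)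
    (hB : ∑ i ∈ B, planeForm φ (a i) = 0) (hm : m ≤ #{i ∈ B | planeForm φ (a i) = c}) :
    ∃ B' ⊆ I ∪ B, #B' = #B ∧ ∑ i ∈ B', a i = 0 := by
  obtain ⟨D, hD, hDm⟩ := exists_subset_card_eq hm
  have hDB : D ⊆ B := hD.trans (filter_subset _ _)
  obtain ⟨T, hT, hTm, hsum⟩ := hI (∑ i ∈ D, a i - ∑ i ∈ B, a i) (by
    rw [map_sub, map_sum, map_sum, hB, sub_zero,
      sum_congr rfl fun i hi => (mem_filter.1 (hD hi)).2, sum_const, hDm])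
  have hdisj : Disjoint T (B \ D) := disjoint_of_subset_left hT
    (disjoint_of_subset_right sdiff_subset hIB)
  have hcard := card_sdiff_add_card_eq_card hDB
  have hsd := sum_sdiff (f := a) hDB
  refine ⟨T ∪ B \ D, union_subset_union hT sdiff_subset, ?_, ?_⟩
  · rw [card_union_of_disjoint hdisj]
    omega
  · rw [sum_union hdisj, hsum, ← hsd]
    abel

/-- The sums from I and from J fill two transverse lines, which add up to the plane. -/
lemma halfSums_univ_of_lines {ι : Type*} [DecidableEq ι] {p : ℕ} [Fact p.Prime]
    [Fintype (ZMod p)]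
    {a : ι → ZMod p × ZMod p} {φ ψ : ZMod p × ZMod p} (h : planeForm (perp φ) ψ ≠ 0)
    {c d : ZMod p} {I J : Finset ι} {m n : ℕ} (hIJ : Disjoint I J) (hIm : #I = 2 * m)
    (hJn : #J = 2 * n)
    (hI : ∀ g, planeForm φ g = m • c → ∃ T ⊆ I, #T = m ∧ ∑ i ∈ T, a i = g)
    (hJ : ∀ g, planeForm ψ g = n • d → ∃ T ⊆ J, #T = n ∧ ∑ i ∈ T, a i = g) :
    HalfSums a (I ∪ J) (m + n) univ := by
  refine ⟨by rw [card_union_of_disjoint hIJ, hIm, hJn, mul_add], fun g _ => ?_⟩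
  obtain ⟨u, hu⟩ := Finite.injective_iff_surjective.1 (planeForm_pair_injective h)
    (m • c, planeForm ψ g - n • d)
  obtain ⟨hu1, hu2⟩ := Prod.mk.inj hu
  obtain ⟨T, hT, hTm, hTs⟩ := hI u hu1
  obtain ⟨T', hT', hTn, hTs'⟩ := hJ (g - u) (by rw [map_sub, hu2, sub_sub_cancel])
  have hdisj : Disjoint T T' := disjoint_of_subset_left hT (disjoint_of_subset_right hT' hIJ)
  exact ⟨T ∪ T', union_subset_union hT hT', by rw [card_union_of_disjoint hdisj, hTm, hTn],
    by rw [sum_union hdisj, hTs, hTs', add_sub_cancel]⟩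

/-! ### The dichotomy. -/

/-- Either all of the plane is covered by the sums of a fixed length of a small subfamily, or
almost all of the family is such that zero-sums modulo some direction can be exchanged for
zero-sums of the same length. -/
theorem exists_cover_or_exchange {ε : ℝ} (hε : 0 < ε) :
    ∃ δ : ℝ, 0 < δ ∧ ∃ P : ℕ, ∀ p : ℕ, p.Prime → P ≤ p →
      ∀ (ι : Type) [DecidableEq ι] (a : ι → ZMod p × ZMod p) (S : Finset ι) [Fintype (ZMod p)],
        (#S : ℝ) ≤ 4 * p → (∀ v, (#{i ∈ S | a i = v} : ℝ) ≤ δ * p) →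
        (∃ I ⊆ S, ∃ m : ℕ, 0 < m ∧ (m : ℝ) ≤ ε / 2 * p ∧ HalfSums a I m univ) ∨
        ∃ R ⊆ S, (#S : ℝ) ≤ #R + ε / 2 * p ∧ ∃ φ : ZMod p × ZMod p,
          ∀ B ⊆ R, ∑ i ∈ B, planeForm φ (a i) = 0 → ε / 8 * p ≤ #B →
            ∃ B' ⊆ S, #B' = #B ∧ ∑ i ∈ B', a i = 0 := by
  obtain ⟨δ₁, hδ₁, P₁, hplane⟩ := exists_halfSums_plane (η := ε / 4) (θ := ε / 2)
    (by positivity) (by positivity)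
  -- At most 4/δ₁ parallel lines are rich, so with the first bound their exchange lengths total at
  -- most εp/8. The second serves the case of two transverse rich lines.
  set θ := min (ε * δ₁ / 32) (ε / 4) with hθdef
  have hθ : 0 < θ := lt_min (by positivity) (by positivity)
  obtain ⟨δ₂, hδ₂, P₂, hline⟩ := exists_line_sums (η := δ₁ / 2) (half_pos hδ₁) hθ
  refine ⟨min δ₂ (δ₁ / 2), lt_min hδ₂ (by positivity), max P₁ P₂, ?_⟩
  intro p hp hpP ι _ a S _ hS hmult
  have : Fact p.Prime := ⟨hp⟩
  have hpR : (0 : ℝ) < p := by exact_mod_cast hp.pos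
  have hmult₂ : ∀ S' ⊆ S, ∀ v, (#{i ∈ S' | a i = v} : ℝ) ≤ δ₂ * p := fun S' hS' v =>
    calc (#{i ∈ S' | a i = v} : ℝ) ≤ #{i ∈ S | a i = v} := by
          exact_mod_cast card_le_card (filter_subset_filter _ hS')
      _ ≤ _ := hmult v
      _ ≤ δ₂ * p := by gcongr; exact min_le_left _ _
  by_cases hcross : ∃ φ ψ c d, planeForm (perp φ) ψ ≠ 0 ∧
      δ₁ * p < (#{i ∈ S | planeForm φ (a i) = c} : ℝ) ∧
      δ₁ * p < (#{i ∈ S | planeForm ψ (a i) = d} : ℝ)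
  · left
    obtain ⟨φ, ψ, c, d, hφψ, hc, hd⟩ := hcross
    have hφ : φ ≠ 0 := by rintro rfl; simp [planeForm_apply, perp] at hφψ
    have hψ : ψ ≠ 0 := by rintro rfl; simp at hφψ
    have hinj := planeForm_pair_injective hφψ
    set L := {i ∈ S | planeForm φ (a i) = c} with hLdef
    set M := {i ∈ S | planeForm ψ (a i) = d} with hMdef
    -- Transverse lines meet in one point, whose multiplicity is small; M \ L stays rich.
    have hinter : (#(M ∩ L) : ℝ) ≤ δ₁ / 2 * p := by
      rcases (M ∩ L).eq_empty_or_nonempty with h | ⟨i, hi⟩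
      · rw [h, card_empty, Nat.cast_zero]
        positivity
      · have hsub : M ∩ L ⊆ {j ∈ S | a j = a i} := by
          intro j hj
          simp only [hMdef, hLdef, mem_inter, mem_filter] at hi hj ⊢
          exact ⟨hj.1.1, hinj (Prod.ext (hj.2.2.trans hi.2.2.symm)
            (hj.1.2.trans hi.1.2.symm))⟩
        calc (#(M ∩ L) : ℝ) ≤ #{j ∈ S | a j = a i} := by exact_mod_cast card_le_card hsub
          _ ≤ _ := hmult _
          _ ≤ _ := by gcongr; exact min_le_right _ _
    have hML : (#(M ∩ L) : ℝ) + #(M \ L) = #M := by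
      exact_mod_cast card_inter_add_card_sdiff M L
    have hLS : L ⊆ S := filter_subset _ _
    have hMS : M \ L ⊆ S := sdiff_subset.trans (filter_subset _ _)
    obtain ⟨I, hI, m, hm, hmp, hIm, hIsum⟩ := hline p hp ((le_max_right _ _).trans hpP) ι a L φ c
      hφ (fun i hi => (mem_filter.1 hi).2) (by nlinarith) (hmult₂ L hLS)
    obtain ⟨J, hJ, n, hn, hnp, hJn, hJsum⟩ := hline p hp ((le_max_right _ _).trans hpP) ι a (M \ L)
      ψ d hψ (fun i hi => (mem_filter.1 (mem_sdiff.1 hi).1).2) (by nlinarith) (hmult₂ _ hMS)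
    refine ⟨I ∪ J, union_subset (hI.trans hLS) (hJ.trans hMS), m + n, by omega, ?_,
      halfSums_univ_of_lines hφψ (disjoint_of_subset_left hI
        (disjoint_of_subset_right hJ disjoint_sdiff)) hIm hJn hIsum hJsum⟩
    have : θ * p ≤ ε / 4 * p := by gcongr; exact min_le_right _ _
    push_cast
    linarith
  push Not at hcross
  obtain ⟨φ, hφ, hpar⟩ : ∃ φ : ZMod p × ZMod p, φ ≠ 0 ∧ ∀ ψ, ψ ≠ 0 → ∀ d,
      δ₁ * p < (#{i ∈ S | planeForm ψ (a i) = d} : ℝ) → planeForm (perp φ) ψ = 0 := by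
    by_cases hrich : ∃ φ c, φ ≠ 0 ∧ δ₁ * p < (#{i ∈ S | planeForm φ (a i) = c} : ℝ)
    · obtain ⟨φ, c, hφ, hc⟩ := hrich
      refine ⟨φ, hφ, fun ψ _ d hd => ?_⟩
      by_contra hne
      exact absurd (hcross φ ψ c d hne hc) (not_le.2 hd)
    · push Not at hrich
      exact ⟨(1, 0), by simp, fun ψ hψ d hd => absurd (hrich ψ d hψ) (not_le.2 hd)⟩
  set C : Finset (ZMod p) := {c | δ₁ * p < (#{i ∈ S | planeForm φ (a i) = c} : ℝ)} with hC
  set R₀ := {i ∈ S | planeForm φ (a i) ∈ C} with hR₀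
  have hR₀S : R₀ ⊆ S := filter_subset _ _
  -- Off the rich lines of φ no line is rich: a rich one would be parallel to them, hence already
  -- inside R₀.
  rcases le_or_gt (ε / 4 * p) (#(S \ R₀) : ℝ) with hbig | hsmall
  · left
    obtain ⟨I, hI, m, hm, hmp, hIm⟩ := hplane p hp ((le_max_left _ _).trans hpP) ι a (S \ R₀) hbig
      (by
        intro ψ hψ d
        by_contra! hlt
        have hsub : {i ∈ S \ R₀ | planeForm ψ (a i) = d} ⊆ {i ∈ S | planeForm ψ (a i) = d} :=
          filter_subset_filter _ sdiff_subset
        have hrich : δ₁ * p < (#{i ∈ S | planeForm ψ (a i) = d} : ℝ) :=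
          hlt.trans_le (by exact_mod_cast card_le_card hsub)
        have hψφ := hpar ψ hψ d hrich
        obtain ⟨i, hi⟩ : {i ∈ S \ R₀ | planeForm ψ (a i) = d}.Nonempty := by
          rw [← card_pos]
          have : (0 : ℝ) < #{i ∈ S \ R₀ | planeForm ψ (a i) = d} :=
            lt_trans (by positivity) hlt
          exact_mod_cast this
        rw [mem_filter, mem_sdiff] at hi
        refine hi.1.2 (mem_filter.2 ⟨hi.1.1, mem_filter.2 ⟨mem_univ _, hrich.trans_le ?_⟩⟩)
        have hsub' : {j ∈ S | planeForm ψ (a j) = d} ⊆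
            {j ∈ S | planeForm φ (a j) = planeForm φ (a i)} :=
          monotone_filter_right _ fun j _ hj =>
            planeForm_eq_of_parallel hψ hψφ (hj.trans hi.2.symm)
        exact_mod_cast card_le_card hsub')
    exact ⟨I, hI.trans sdiff_subset, m, hm, hmp, hIm⟩
  · right
    have hex : ∀ c ∈ C, ∃ I ⊆ {i ∈ S | planeForm φ (a i) = c}, ∃ m : ℕ, 0 < m ∧
        (m : ℝ) ≤ θ * p ∧ #I = 2 * m ∧
          ∀ g, planeForm φ g = m • c → ∃ T ⊆ I, #T = m ∧ ∑ i ∈ T, a i = g := by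
      intro c hc
      refine hline p hp ((le_max_right _ _).trans hpP) ι a _ φ c hφ
        (fun i hi => (mem_filter.1 hi).2) ?_ (hmult₂ _ (filter_subset _ _))
      have := (mem_filter.1 hc).2
      nlinarith
    choose! I hI m hm hmp hIm hIsum using hex
    have hCcard : (#C : ℝ) * δ₁ ≤ 4 := by
      have h1 : #R₀ = ∑ c ∈ C, #{i ∈ R₀ | planeForm φ (a i) = c} :=
        card_eq_sum_card_fiberwise fun i hi => (mem_filter.1 hi).2
      have h2 : (#C : ℝ) * (δ₁ * p) ≤ #R₀ := by
        rw [h1, Nat.cast_sum, ← nsmul_eq_mul, ← sum_const]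
        refine sum_le_sum fun c hc => ?_
        refine (mem_filter.1 hc).2.le.trans ?_
        have hsub : {i ∈ S | planeForm φ (a i) = c} ⊆ {i ∈ R₀ | planeForm φ (a i) = c} := by
          intro i hi
          rw [mem_filter] at hi ⊢
          exact ⟨mem_filter.2 ⟨hi.1, by rw [hi.2]; exact hc⟩, hi.2⟩
        exact_mod_cast card_le_card hsub
      have h3 : (#R₀ : ℝ) ≤ 4 * p := le_trans (by exact_mod_cast card_le_card hR₀S) hS
      have h4 : (#C : ℝ) * δ₁ * p ≤ 4 * p := by linarith
      exact le_of_mul_le_mul_right h4 hpR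
    have hCθ : (#C : ℝ) * (θ * p) ≤ ε / 8 * p := by
      have h1 : (#C : ℝ) * θ ≤ #C * (ε * δ₁ / 32) := by gcongr; exact min_le_left _ _
      have h2 : (#C : ℝ) * θ ≤ ε / 8 := by nlinarith
      nlinarith
    refine ⟨R₀ \ C.biUnion I, sdiff_subset.trans hR₀S, ?_, φ, ?_⟩
    · have h1 : (#(C.biUnion I) : ℝ) ≤ ε / 4 * p := by
        calc (#(C.biUnion I) : ℝ) ≤ ∑ c ∈ C, (#(I c) : ℝ) := by exact_mod_cast card_biUnion_le
          _ ≤ ∑ c ∈ C, 2 * (θ * p) := by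
            refine sum_le_sum fun c hc => ?_
            rw [hIm c hc]
            push_cast
            linarith [hmp c hc]
          _ = 2 * (#C * (θ * p)) := by rw [sum_const, nsmul_eq_mul]; ring
          _ ≤ _ := by linarith
      have h2 : (#R₀ : ℝ) ≤ #(R₀ \ C.biUnion I) + #(C.biUnion I) := by
        exact_mod_cast card_le_card_sdiff_add_card
      have h3 : (#(S \ R₀) : ℝ) + #R₀ = #S := by
        exact_mod_cast card_sdiff_add_card_eq_card hR₀S
      linarith
    · intro B hB hsum hBcard
      -- Otherwise B would have fewer than |C|θp ≤ εp/8 elements.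
      obtain ⟨c, hc, hmc⟩ : ∃ c ∈ C, m c ≤ #{i ∈ B | planeForm φ (a i) = c} := by
        by_contra! hcon
        have h1 : #B = ∑ c ∈ C, #{i ∈ B | planeForm φ (a i) = c} :=
          card_eq_sum_card_fiberwise fun i hi => (mem_filter.1 (mem_sdiff.1 (hB hi)).1).2
        rcases C.eq_empty_or_nonempty with hC0 | hC0
        · rw [hC0, sum_empty] at h1
          rw [h1, Nat.cast_zero] at hBcard
          exact absurd hBcard (not_le.2 (by positivity))
        · have h2 : (#B : ℝ) < #C * (θ * p) := by
            rw [h1, Nat.cast_sum, ← nsmul_eq_mul, ← sum_const]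
            refine sum_lt_sum_of_nonempty hC0 fun c hc => lt_of_lt_of_le ?_ (hmp c hc)
            exact_mod_cast hcon c hc
          linarith
      have hdisj : Disjoint (I c) B := disjoint_of_subset_right hB
        (disjoint_of_subset_left (subset_biUnion_of_mem I hc) disjoint_sdiff)
      obtain ⟨B', hB', hcard, hzero⟩ := exists_exchange hdisj (hIsum c hc) hsum hmc
      exact ⟨B', hB'.trans (union_subset ((hI c hc).trans (filter_subset _ _))
        (hB.trans (sdiff_subset.trans hR₀S))), hcard, hzero⟩

/-! ### Conclusion for indexed families and for multisets. -/

/-- The indexed version of the existence of zero-sums of length at most `p`, respectively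
equal to `p`, in the plane over `ZMod p`. -/
theorem exists_zero_sum_plane {ε : ℝ} (hε : 0 < ε) (hε1 : ε ≤ 1) :
    ∃ δ : ℝ, 0 < δ ∧ ∃ P : ℕ, ∀ p : ℕ, p.Prime → P ≤ p →
      ∀ (ι : Type) [DecidableEq ι] (a : ι → ZMod p × ZMod p) (S : Finset ι),
        (∀ v, (#{i ∈ S | a i = v} : ℝ) ≤ δ * p) →
        ((1 + ε) * p < #S → ∃ T ⊆ S, T.Nonempty ∧ #T ≤ p ∧ ∑ i ∈ T, a i = 0) ∧
        ((2 + ε) * p < #S → ∃ T ⊆ S, #T = p ∧ ∑ i ∈ T, a i = 0) := by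
  obtain ⟨δ, hδ, P, hmain⟩ := exists_cover_or_exchange hε
  obtain ⟨Q, hQ⟩ := exists_nat_gt (4 / ε)
  refine ⟨δ, hδ, max P Q, ?_⟩
  intro p hp hpP ι _ a S₀ hmult
  have : Fact p.Prime := ⟨hp⟩
  have hpR : (0 : ℝ) < p := by exact_mod_cast hp.pos
  have hεp : 4 ≤ ε * p := by
    have hQp : (Q : ℝ) ≤ p := by exact_mod_cast (le_max_right P Q).trans hpP
    have := hQ.le.trans hQp
    rwa [div_le_iff₀ hε, mul_comm] at this
  have hεp1 : ε * p ≤ p := mul_le_of_le_one_left hpR.le hε1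
  -- Discarding elements gives the bound 4p, which limits the number of rich lines.
  have htrim : ∀ b : ℝ, 0 ≤ b → b ≤ 3 → b * p < #S₀ → ∃ S ⊆ S₀, b * p < #S ∧
      (#S : ℝ) ≤ 4 * p ∧ ∀ v, (#{i ∈ S | a i = v} : ℝ) ≤ δ * p := by
    intro b hb0 hb hbS
    obtain ⟨S, hS, hcard⟩ := exists_subset_card_eq (Nat.floor_lt (by positivity) |>.2 hbS)
    have h1 : (#S : ℝ) = ⌊b * (p : ℝ)⌋₊ + 1 := by rw [hcard]; push_cast; rfl
    refine ⟨S, hS, by rw [h1]; exact Nat.lt_floor_add_one _, ?_, fun v => le_trans ?_ (hmult v)⟩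
    · rw [h1]
      have := Nat.floor_le (by positivity : 0 ≤ b * (p : ℝ))
      nlinarith
    · exact_mod_cast card_le_card (filter_subset_filter _ hS)
  constructor
  · intro hcard
    obtain ⟨S, hS, hlow, hup, hmultS⟩ := htrim _ (by linarith) (by linarith) hcard
    rcases hmain p hp ((le_max_left _ _).trans hpP) ι a S hup hmultS with
      ⟨I, hI, m, hm, hmp, hIm⟩ | ⟨R, hR, hRcard, φ, hexch⟩
    · obtain ⟨T, hT, hTm, hsum⟩ := hIm.2 0 (mem_univ _)
      refine ⟨T, hT.trans (hI.trans hS), card_pos.1 (by omega), ?_, hsum⟩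
      have : (m : ℝ) ≤ p := by linarith
      rw [hTm]
      exact_mod_cast this
    -- The exchange needs a zero-sum with at least εp/8 terms; the surplus εp/2 in R pays for this
    -- lower bound.
    · have hN := Nat.ceil_lt_add_one (by positivity : 0 ≤ ε / 8 * (p : ℝ))
      obtain ⟨B, hB, hBN, hBp, hsum⟩ := exists_zero_sum_card_mem_Icc hp.pos
        (fun i => planeForm φ (a i)) R (N := ⌈ε / 8 * (p : ℝ)⌉₊)
        (by
          have : 2 * (⌈ε / 8 * (p : ℝ)⌉₊ : ℝ) ≤ p := by linarith
          exact_mod_cast this)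
        (by
          have : (p : ℝ) + ⌈ε / 8 * (p : ℝ)⌉₊ ≤ #R := by linarith
          exact_mod_cast this)
      have hBε : ε / 8 * p ≤ #B := (Nat.le_ceil _).trans (by exact_mod_cast hBN)
      obtain ⟨B', hB', hcard', hzero⟩ := hexch B hB hsum hBε
      refine ⟨B', hB'.trans hS, card_pos.1 ?_, by omega, hzero⟩
      have : (0 : ℝ) < #B' := by rw [hcard']; linarith
      exact_mod_cast this
  · intro hcard
    obtain ⟨S, hS, hlow, hup, hmultS⟩ := htrim _ (by linarith) (by linarith) hcard
    rcases hmain p hp ((le_max_left _ _).trans hpP) ι a S hup hmultS with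
      ⟨I, hI, m, hm, hmp, hIm⟩ | ⟨R, hR, hRcard, φ, hexch⟩
    · have hmp' : m ≤ p := by
        have : (m : ℝ) ≤ p := by linarith
        exact_mod_cast this
      have hSI : (#(S \ I) : ℝ) + 2 * m = #S := by
        rw [← card_sdiff_add_card_eq_card hI, hIm.1]
        push_cast
        ring
      obtain ⟨F, hF, hFcard⟩ := exists_subset_card_eq (s := S \ I) (n := p - m) (by
        have h : (p : ℝ) ≤ #(S \ I) := by linarith
        have h' : p ≤ #(S \ I) := by exact_mod_cast h
        omega)
      obtain ⟨T, hT, hTm, hsum⟩ := hIm.2 (-∑ i ∈ F, a i) (mem_univ _)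
      have hdisj : Disjoint T F := disjoint_of_subset_left hT
        (disjoint_of_subset_right hF disjoint_sdiff)
      refine ⟨T ∪ F, (union_subset (hT.trans hI) (hF.trans sdiff_subset)).trans hS, ?_, ?_⟩
      · rw [card_union_of_disjoint hdisj]
        omega
      · rw [sum_union hdisj, hsum, neg_add_cancel]
    · obtain ⟨B, hB, hBp, hsum⟩ := ZMod.erdos_ginzburg_ziv (n := p) (s := R)
        (fun i => planeForm φ (a i)) (by
          have h : 2 * (p : ℝ) ≤ #R := by linarith
          have h' : 2 * p ≤ #R := by exact_mod_cast h
          omega)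
      obtain ⟨B', hB', hcard', hzero⟩ := hexch B hB hsum (by rw [hBp]; linarith)
      exact ⟨B', hB'.trans hS, by omega, hzero⟩

theorem theorem4 :
    ∀ ε : ℝ, 0 < ε → ∃ δ : ℝ, 0 < δ ∧ ∃ P : ℕ, ∀ p : ℕ, p.Prime → P ≤ p →
      ∀ A : Multiset (ZMod p × ZMod p),
        (∀ a ∈ A, (A.count a : ℝ) < δ * (p : ℝ)) →
          ((1 + ε) * (p : ℝ) < (Multiset.card A : ℝ) →
            ∃ B : Multiset (ZMod p × ZMod p),
              B ≤ A ∧ B ≠ 0 ∧ Multiset.card B ≤ p ∧ B.sum = 0) ∧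
          ((2 + ε) * (p : ℝ) < (Multiset.card A : ℝ) →
            ∃ B : Multiset (ZMod p × ZMod p),
              B ≤ A ∧ Multiset.card B = p ∧ B.sum = 0) := by
  intro ε hε
  obtain ⟨δ, hδ, P, hmain⟩ := exists_zero_sum_plane (lt_min hε one_pos) (min_le_right ε 1)
  refine ⟨δ, hδ, P, fun p hp hpP A hA => ?_⟩
  have hpR : (0 : ℝ) < p := by exact_mod_cast hp.pos
  have hmult : ∀ v, (#{i ∈ A.toEnumFinset | i.1 = v} : ℝ) ≤ δ * p := by
    intro v
    have hcount : #{i ∈ A.toEnumFinset | i.1 = v} = A.count v := by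
      conv_rhs => rw [← A.map_toEnumFinset_fst, Multiset.count_map]
      simp_rw [eq_comm (a := v)]
      rfl
    rw [hcount]
    by_cases hv : v ∈ A
    · exact (hA v hv).le
    · rw [Multiset.count_eq_zero_of_notMem hv, Nat.cast_zero]
      positivity
  obtain ⟨hshort, hexact⟩ := hmain p hp hpP _ Prod.fst A.toEnumFinset hmult
  rw [Multiset.card_toEnumFinset] at hshort hexact
  constructor
  · intro hcard
    obtain ⟨T, hT, hne, hTp, hsum⟩ := hshort
      (lt_of_le_of_lt (by gcongr; exact min_le_left _ _) hcard)
    refine ⟨T.1.map Prod.fst, Multiset.map_fst_le_of_subset_toEnumFinset hT, ?_, ?_, hsum⟩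
    · rw [ne_eq, Multiset.map_eq_zero, Finset.val_eq_zero]
      exact hne.ne_empty
    · rw [Multiset.card_map]
      exact hTp
  · intro hcard
    obtain ⟨T, hT, hTp, hsum⟩ := hexact
      (lt_of_le_of_lt (by gcongr; exact min_le_left _ _) hcard)
    exact ⟨T.1.map Prod.fst, Multiset.map_fst_le_of_subset_toEnumFinset hT,
      by rw [Multiset.card_map]; exact hTp, hsum⟩
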